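/- Let $N\ge 1$, $0<s<1<p<N/s$, and put $$\|u\|_{s,p}^p=\int_{\mathbb R^N\times\mathbb R^N}\frac{|u(x)-u(y)|^p}{|x-y|^{N+sp}}\,dx\,dy .$$ Let $\mathcal D^{s,p}(\mathbb R^N)$ be the completion of $C_c^1(\mathbb R^N)$ with respect to $\|\cdot\|_{s,p}$, realised as a space of functions in $L^{Np/(N-sp)}(\mathbb R^N)$. For bounded measurable $F\subset\mathbb R^N$ let $$\mathrm{Cap}_{s,p}(F)=\inf\{\|u\|_{s,p}^p : u\in\mathcal D^{s,p}(\mathbb R^N),\ u\ge 1\text{ a.e. in }F\},$$ let $\|w\|_{\mathcal H_{s,p}}=\sup_F \int_F|w|\,dx\,/\,\mathrm{Cap}_{s,p}(F)$, the supremum being over all bounded measurable $F$ of positive measure, let $\mathcal H_{s,p}(\mathbb R^N)=\{w\in L^1_{loc}(\mathbb R^N):\|w\|_{\mathcal H_{s,p}}<\infty\}$, and let $\mathcal H_{s,p,0}(\mathbb R^N)$ be the closure of $C_c(\mathbb R^N)$ in $\mathcal H_{s,p}(\mathbb R^N)$. Let $w=w_1-w_2$ with $w_1,w_2\ge 0$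 a.e., $w_1\in\mathcal H_{s,p,0}(\mathbb R^N)$ and $w_2\in L^1_{loc}(\mathbb R^N)$. An eigenfunction of $$(-\Delta_p)^s u=\lambda\, w\,|u|^{p-2}u\quad\text{in }\mathbb R^N$$ for $\lambda\in\mathbb R$ is a function $u\in\mathcal D^{s,p}(\mathbb R^N)$, not a.e. equal to $0$, such that for all $v\in\mathcal D^{s,p}(\mathbb R^N)$ the function $w|u|^{p-2}uv$ is integrable and $$\int_{\mathbb R^N\times\mathbb R^N}\frac{|u(x)-u(y)|^{p-2}(u(x)-u(y))(v(x)-v(y))}{|x-y|^{N+sp}}\,dx\,dy=\lambda\int_{\mathbb R^N}w|u|^{p-2}uv\,dx .$$ Let $\lambda_1=\inf\{\|u\|_{s,p}^p : u\in\mathcal D^{s,p}(\mathbb R^N),\ w|u|^p\in L^1(\mathbb R^N),\ \int_{\mathbb R^N}w|u|^p\,dx=1\}$ (with $\inf\emptyset=+\infty$). A first eigenfunction is an eigenfunction for $\lambda=\lambda_1<\infty$. Then: 1. Every first eigenfunction has constant sign: $u\ge 0$ a.e. or $u\le 0$ a.e. in $\mathbb R^N$. 2. A first eigenfunction $u$ with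 $u\ge 0$ a.e. satisfies $u>0$ a.e. in $\mathbb R^N$. 3. $\lambda_1$ is simple: if $u$ and $v$ are first eigenfunctions, then $u=cv$ a.e. in $\mathbb R^N$ for some constant $c\ne 0$. -/

import Mathlib

open MeasureTheory Filter Topology
open scoped ENNReal

namespace FracHardy

/-- The `p`-th power of the Gagliardo seminorm,
`∬ |u(x) - u(y)|^p / |x - y|^(N + s p) dx dy`, with values in `[0, ∞]`. -/
noncomputable def energy {N : ℕ} (s p : ℝ) (u : EuclideanSpace ℝ (Fin N) → ℝ) : ℝ≥0∞ :=
  ∫⁻ z : EuclideanSpace ℝ (Fin N) × EuclideanSpace ℝ (Fin N),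
    ENNReal.ofReal (|u z.1 - u z.2| ^ p / ‖z.1 - z.2‖ ^ ((N : ℝ) + s * p))

/-- The fractional critical Sobolev exponent `N p / (N - s p)`. -/
noncomputable def critExp (N : ℕ) (s p : ℝ) : ℝ≥0∞ :=
  ENNReal.ofReal ((N : ℝ) * p / ((N : ℝ) - s * p))

/-- The space `D^{s,p}(ℝ^N)`, the completion of `C_c^1(ℝ^N)` for the Gagliardo seminorm, as a space
of functions: `u` is the limit of a sequence in `C_c^1(ℝ^N)` in the seminorm and in the critical
Lebesgue space (for `s p < N` a sequence in `C_c^1` that is Cauchy for the seminorm also converges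
in the critical Lebesgue space, by the fractional Sobolev inequality, and its limit there is the
function that represents its class in the completion). -/
def MemD {N : ℕ} (s p : ℝ) (u : EuclideanSpace ℝ (Fin N) → ℝ) : Prop :=
  AEStronglyMeasurable u volume ∧
  ∃ φ : ℕ → EuclideanSpace ℝ (Fin N) → ℝ,
    (∀ n, ContDiff ℝ 1 (φ n) ∧ HasCompactSupport (φ n)) ∧
    Tendsto (fun n => energy s p (φ n - u)) atTop (𝓝 0) ∧
    Tendsto (fun n => eLpNorm (φ n - u) (critExp N s p) volume) atTop (𝓝 0)

/-- The `(s,p)`-capacity of `F` relative to `ℝ^N`. -/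
noncomputable def cap {N : ℕ} (s p : ℝ) (F : Set (EuclideanSpace ℝ (Fin N))) : ℝ≥0∞ :=
  ⨅ (u : EuclideanSpace ℝ (Fin N) → ℝ) (_ : MemD s p u ∧ ∀ᵐ x ∂volume, x ∈ F → 1 ≤ u x),
    energy s p u

/-- The norm `sup_F (∫_F |w|) / Cap_{s,p}(F)` over relatively compact (that is, bounded) measurable
sets `F`; null sets contribute `0 / 0 = 0`. -/
noncomputable def hardyNorm {N : ℕ} (s p : ℝ) (w : EuclideanSpace ℝ (Fin N) → ℝ) : ℝ≥0∞ :=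
  ⨆ (F : Set (EuclideanSpace ℝ (Fin N))) (_ : MeasurableSet F ∧ Bornology.IsBounded F),
    (∫⁻ x in F, ‖w x‖ₑ) / cap s p F

/-- The space `H_{s,p}(ℝ^N)` of `(s,p)`-Hardy potentials. -/
def MemHardy {N : ℕ} (s p : ℝ) (w : EuclideanSpace ℝ (Fin N) → ℝ) : Prop :=
  LocallyIntegrable w volume ∧ hardyNorm s p w < ∞

/-- The space `H_{s,p,0}(ℝ^N)`, the closure of `C_c(ℝ^N)` in `H_{s,p}(ℝ^N)`. -/
def MemHardyZero {N : ℕ} (s p : ℝ) (w : EuclideanSpace ℝ (Fin N) → ℝ) : Prop :=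
  MemHardy s p w ∧
  ∀ ε : ℝ≥0∞, 0 < ε → ∃ φ : EuclideanSpace ℝ (Fin N) → ℝ,
    Continuous φ ∧ HasCompactSupport φ ∧ hardyNorm s p (w - φ) < ε

/-- `u` is an eigenfunction of `(-Δ_p)^s u = lam w |u|^(p-2) u` in `ℝ^N` for the eigenvalue `lam`:
it is a nonzero element of `D^{s,p}` and satisfies the weak equation (whose right-hand side is
required to be an absolutely convergent integral) for all test functions in `D^{s,p}`. -/
def IsEigenfunction {N : ℕ} (s p : ℝ) (w : EuclideanSpace ℝ (Fin N) → ℝ) (lam : ℝ)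
    (u : EuclideanSpace ℝ (Fin N) → ℝ) : Prop :=
  MemD s p u ∧ ¬ (u =ᵐ[volume] 0) ∧
  ∀ v : EuclideanSpace ℝ (Fin N) → ℝ, MemD s p v →
    Integrable (fun x => w x * (|u x| ^ (p - 2) * u x) * v x) volume ∧
    ∫ z : EuclideanSpace ℝ (Fin N) × EuclideanSpace ℝ (Fin N),
        |u z.1 - u z.2| ^ (p - 2) * (u z.1 - u z.2) * (v z.1 - v z.2)
          / ‖z.1 - z.2‖ ^ ((N : ℝ) + s * p)
      = lam * ∫ x, w x * (|u x| ^ (p - 2) * u x) * v x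

/-- `inf { ‖u‖_{s,p}^p : u ∈ D^{s,p}, ∫ w |u|^p = 1 }`, with `inf ∅ = ∞`. -/
noncomputable def firstEigenvalue {N : ℕ} (s p : ℝ) (w : EuclideanSpace ℝ (Fin N) → ℝ) : ℝ≥0∞ :=
  ⨅ (u : EuclideanSpace ℝ (Fin N) → ℝ)
    (_ : MemD s p u ∧ Integrable (fun x => w x * |u x| ^ p) volume ∧ ∫ x, w x * |u x| ^ p = 1),
    energy s p u

/-- `u` is an eigenfunction for the (finite) first eigenvalue. -/
def IsFirstEigenfunction {N : ℕ} (s p : ℝ) (w : EuclideanSpace ℝ (Fin N) → ℝ)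
    (u : EuclideanSpace ℝ (Fin N) → ℝ) : Prop :=
  firstEigenvalue s p w ≠ ∞ ∧ IsEigenfunction s p w (firstEigenvalue s p w).toReal u

end FracHardy

/-! Testing the equation with the eigenfunction itself gives energy `λ₁ ∫ w|u|^p`. The integral must
be positive, since otherwise the energy vanishes and so does `u`. Hence first eigenfunctions are, up
to scaling, minimizers for `λ₁` (`IsFirstEigenfunction.isMinimizer`).

Simplicity is hidden convexity. For minimizers `u`, `v` put `σ = (|u|^p + |v|^p)^(1/p)`. The
weighted integral is additive, `∫ w σ^p = ∫ w|u|^p + ∫ w|v|^p`, whatever the sign of `w`, while the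
reverse triangle inequality in `ℓ^p` makes the energy density of `σ` at most the sum of those of `u`
and `v`. Minimality forces equality a.e., and strict convexity of `ℓ^p` then makes `(u(x), v(x))`
and `(u(y), v(y))` parallel for a.e. `(x, y)`, so `u` and `v` are proportional. No sign or
positivity is needed beforehand, so constant sign follows by comparing `u` with the minimizer `|u|`.

Positivity uses the equation and local integrability of `w`: the test functions `(η - m|u|)₊` with
`m → ∞` concentrate on `{u = 0}`. The right-hand side tends to `0`, while pairs with `u(x) > 0 =
u(y)` contribute a strictly negative amount on the left (`ae_not_pos_and_zero_of_isEigenfunction`).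

Both arguments need the test functions to lie in `D^{s,p}`, which is supplied by
`MemD.comp_lipschitz`. -/

namespace FracHardy

/-! ### Mollification of Lipschitz maps and generalized dominated convergence -/

open scoped Convolution NNReal in
/-- A Lipschitz function vanishing at the origin is a pointwise limit of `C^1` functions with the
same properties and the same Lipschitz constant. -/
theorem exists_contDiff_lipschitz_approx {E : Type*} [NormedAddCommGroup E] [NormedSpace ℝ E]
    [FiniteDimensional ℝ E] [MeasurableSpace E] [BorelSpace E] {L : ℝ≥0} {T : E → ℝ}
    (hT : LipschitzWith L T) (hT0 : T 0 = 0) :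
    ∃ S : ℕ → E → ℝ, (∀ n, ContDiff ℝ 1 (S n) ∧ LipschitzWith L (S n) ∧ S n 0 = 0) ∧
      ∀ x, Tendsto (fun n => S n x) atTop (𝓝 (T x)) := by
  let μ : Measure E := Measure.addHaar
  let φ : ℕ → ContDiffBump (0 : E) := fun n =>
    ⟨1 / (n + 1 : ℝ) / 2, 1 / (n + 1 : ℝ), by positivity, by
      have : 0 < 1 / (n + 1 : ℝ) := by positivity
      linarith⟩
  let C : ℕ → E → ℝ := fun n => (φ n).normed μ ⋆[ContinuousLinearMap.lsmul ℝ ℝ, μ] T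
  have hφ : Tendsto (fun n => (φ n).rOut) atTop (𝓝 0) := tendsto_one_div_add_atTop_nhds_zero_nat
  have hC (x : E) : Tendsto (fun n => C n x) atTop (𝓝 (T x)) :=
    ContDiffBump.convolution_tendsto_right_of_continuous hφ hT.continuous x
  have hint (n : ℕ) (x : E) : Integrable (fun t => (φ n).normed μ t * T (x - t)) μ := by
    refine Continuous.integrable_of_hasCompactSupport ?_ ?_
    · exact (φ n).continuous_normed.mul (hT.continuous.comp (by fun_prop))
    · exact (φ n).hasCompactSupport_normed.mul_right
  have hCL (n : ℕ) : LipschitzWith L (C n) := by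
    refine LipschitzWith.of_dist_le_mul fun x y => ?_
    have e : C n x - C n y = ∫ t, (φ n).normed μ t * (T (x - t) - T (y - t)) ∂μ := by
      simp only [C, convolution, ContinuousLinearMap.lsmul_apply, smul_eq_mul, mul_sub]
      rw [integral_sub (hint n x) (hint n y)]
    rw [Real.dist_eq, e, ← Real.norm_eq_abs]
    calc _ ≤ ∫ t, (φ n).normed μ t * (L * dist x y) ∂μ := by
          refine norm_integral_le_of_norm_le ((φ n).integrable_normed.mul_const _) (ae_of_all _ fun t => ?_)
          rw [norm_mul, Real.norm_of_nonneg ((φ n).nonneg_normed t)]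
          refine mul_le_mul_of_nonneg_left ?_ ((φ n).nonneg_normed t)
          simpa [Real.dist_eq] using hT.dist_le_mul (x - t) (y - t)
      _ = L * dist x y := by
          rw [integral_mul_const, (φ n).integral_normed, one_mul]
  -- Mollifying loses the value at the origin. Subtracting `C n 0`, which tends to `T 0 = 0`,
  -- restores it; this is what later keeps supports compact under composition.
  refine ⟨fun n x => C n x - C n 0, fun n => ⟨?_, ?_, sub_self _⟩, fun x => ?_⟩
  · refine ContDiff.sub ?_ contDiff_const
    exact (φ n).hasCompactSupport_normed.contDiff_convolution_left _ (φ n).contDiff_normed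
      hT.continuous.locallyIntegrable
  · refine LipschitzWith.of_dist_le_mul fun x y => ?_
    simpa using (hCL n).dist_le_mul x y
  · simpa [hT0] using (hC x).sub (hC 0)

/-- Dominated convergence in `L^q` with a dominating sequence that converges in `L^q`. -/
theorem tendsto_eLpNorm_of_dominated {α : Type*} [MeasurableSpace α] {μ : Measure α} {q : ℝ}
    (hq : 1 ≤ q) {g : ℕ → α → ℝ} {g₀ f₀ : α → ℝ} {f : ℕ → α → ℝ}
    (hg : ∀ n, AEStronglyMeasurable (g n) μ) (hg₀ : AEStronglyMeasurable g₀ μ)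
    (hf : ∀ n, AEStronglyMeasurable (f n) μ) (hf₀ : MemLp f₀ (ENNReal.ofReal q) μ)
    (hlim : ∀ᵐ x ∂μ, Tendsto (fun n => g n x) atTop (𝓝 (g₀ x)))
    (hdom : ∀ n, ∀ᵐ x ∂μ, |g n x - g₀ x| ≤ f₀ x + |f n x|)
    (hf_lim : Tendsto (fun n => eLpNorm (f n) (ENNReal.ofReal q) μ) atTop (𝓝 0)) :
    Tendsto (fun n => eLpNorm (g n - g₀) (ENNReal.ofReal q) μ) atTop (𝓝 0) := by
  have hq0 : 0 < q := by linarith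
  -- The excess over `|f n|` is dominated by the fixed function `|f₀|`, so ordinary dominated
  -- convergence applies to it; the rest is small because `f n` is.
  let h : ℕ → α → ℝ := fun n x => max (|g n x - g₀ x| - |f n x|) 0
  have hh (n : ℕ) : AEStronglyMeasurable (h n) μ :=
    ((((hg n).sub hg₀).norm).sub (hf n).norm).sup aestronglyMeasurable_const
  have h1 : Tendsto (fun n => eLpNorm (h n) (ENNReal.ofReal q) μ) atTop (𝓝 0) := by
    have hne : ENNReal.ofReal q ≠ 0 := by simpa using hq0
    have key : Tendsto (fun n => ∫⁻ x, ‖h n x‖ₑ ^ q ∂μ) atTop (𝓝 (∫⁻ _, 0 ∂μ)) := by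
      refine tendsto_lintegral_of_dominated_convergence' (fun x => ‖f₀ x‖ₑ ^ q)
        (fun n => (hh n).enorm.pow_const q) (fun n => ?_) ?_ ?_
      · filter_upwards [hdom n] with x hx
        refine ENNReal.rpow_le_rpow ?_ hq0.le
        refine enorm_le_iff_norm_le.2 ?_
        have : 0 ≤ h n x := le_max_right _ _
        rw [Real.norm_of_nonneg this, Real.norm_eq_abs]
        refine max_le ?_ (abs_nonneg _)
        linarith [le_abs_self (f₀ x)]
      · have := lintegral_rpow_enorm_lt_top_of_eLpNorm_lt_top hne ENNReal.ofReal_ne_top hf₀.2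
        rw [ENNReal.toReal_ofReal hq0.le] at this
        exact this.ne
      · filter_upwards [hlim] with x hx
        have hx0 : Tendsto (fun n => |g n x - g₀ x|) atTop (𝓝 0) := by
          simpa using (hx.sub_const (g₀ x)).abs
        have : Tendsto (fun n => h n x) atTop (𝓝 0) := by
          refine squeeze_zero (fun n => le_max_right _ _) (fun n => ?_) hx0
          exact max_le (by linarith [abs_nonneg (f n x)]) (abs_nonneg _)
        have h2 := (ENNReal.continuous_rpow_const (y := q)).tendsto _ |>.comp this.enorm
        simpa [hq0, Function.comp_def] using h2
    have h3 := (ENNReal.continuous_rpow_const (y := 1 / q)).tendsto _ |>.comp key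
    simp only [lintegral_zero] at h3
    rw [ENNReal.zero_rpow_of_pos (by positivity)] at h3
    refine h3.congr fun n => ?_
    simp [eLpNorm_eq_lintegral_rpow_enorm_toReal hne ENNReal.ofReal_ne_top, hq0.le]
  refine tendsto_of_tendsto_of_tendsto_of_le_of_le tendsto_const_nhds
    (by simpa using h1.add hf_lim) (fun n => zero_le) fun n => ?_
  calc eLpNorm (g n - g₀) (ENNReal.ofReal q) μ
      ≤ eLpNorm (h n + fun x => |f n x|) (ENNReal.ofReal q) μ := by
        refine eLpNorm_mono_real fun x => ?_
        have : |g n x - g₀ x| - |f n x| ≤ h n x := le_max_left _ _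
        simp only [Pi.sub_apply, Pi.add_apply, Real.norm_eq_abs]
        linarith
    _ ≤ eLpNorm (h n) (ENNReal.ofReal q) μ + eLpNorm (fun x => |f n x|) (ENNReal.ofReal q) μ :=
        eLpNorm_add_le (hh n) (hf n).norm (by simpa using hq)
    _ = _ := by rw [show (fun x => |f n x|) = fun x => ‖f n x‖ from rfl, eLpNorm_norm]

/-! ### Difference quotients and Lipschitz stability of `D^{s,p}` -/

variable {N : ℕ} {s p : ℝ}

/-- The fractional difference quotient `(u(x) - u(y)) / |x - y|^((N + s p) / p)`. -/
noncomputable def gquot (s p : ℝ) (u : EuclideanSpace ℝ (Fin N) → ℝ) :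
    EuclideanSpace ℝ (Fin N) × EuclideanSpace ℝ (Fin N) → ℝ :=
  fun z => (u z.1 - u z.2) / ‖z.1 - z.2‖ ^ (((N : ℝ) + s * p) / p)

theorem rpow_div_rpow (hp : 0 < p) (r : ℝ) (hr : 0 ≤ r) :
    (r ^ (((N : ℝ) + s * p) / p)) ^ p = r ^ ((N : ℝ) + s * p) := by
  rw [← Real.rpow_mul hr, div_mul_cancel₀ _ hp.ne']

theorem abs_gquot_rpow (hp : 0 < p) (u : EuclideanSpace ℝ (Fin N) → ℝ)
    (z : EuclideanSpace ℝ (Fin N) × EuclideanSpace ℝ (Fin N)) :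
    |gquot s p u z| ^ p = |u z.1 - u z.2| ^ p / ‖z.1 - z.2‖ ^ ((N : ℝ) + s * p) := by
  rw [gquot, abs_div, Real.div_rpow (abs_nonneg _) (abs_nonneg _),
    abs_of_nonneg (Real.rpow_nonneg (norm_nonneg _) _), rpow_div_rpow hp _ (norm_nonneg _)]

theorem energy_eq_lintegral (hp : 0 < p) (u : EuclideanSpace ℝ (Fin N) → ℝ) :
    energy s p u = ∫⁻ z, ‖gquot s p u z‖ₑ ^ p := by
  refine lintegral_congr fun z => ?_
  rw [← abs_gquot_rpow hp, ← ofReal_norm, Real.norm_eq_abs,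
    ENNReal.ofReal_rpow_of_nonneg (abs_nonneg _) hp.le]

theorem eLpNorm_gquot (hp : 0 < p) (u : EuclideanSpace ℝ (Fin N) → ℝ) :
    eLpNorm (gquot s p u) (ENNReal.ofReal p) volume = energy s p u ^ (1 / p) := by
  rw [energy_eq_lintegral hp, eLpNorm_eq_lintegral_rpow_enorm_toReal (by simpa using hp)
    ENNReal.ofReal_ne_top, ENNReal.toReal_ofReal hp.le]

theorem gquot_sub (u v : EuclideanSpace ℝ (Fin N) → ℝ) :
    gquot s p (u - v) = gquot s p u - gquot s p v := by
  ext z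
  simp only [gquot, Pi.sub_apply]
  ring

theorem tendsto_energy_zero_iff (hp : 0 < p) (f : ℕ → EuclideanSpace ℝ (Fin N) → ℝ) :
    Tendsto (fun n => energy s p (f n)) atTop (𝓝 0) ↔
      Tendsto (fun n => eLpNorm (gquot s p (f n)) (ENNReal.ofReal p) volume) atTop (𝓝 0) := by
  simp only [eLpNorm_gquot hp]
  constructor <;> intro h
  · have := (ENNReal.continuous_rpow_const (y := 1 / p)).tendsto _ |>.comp h
    rwa [ENNReal.zero_rpow_of_pos (by positivity)] at this
  · have := (ENNReal.continuous_rpow_const (y := p)).tendsto _ |>.comp h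
    rw [ENNReal.zero_rpow_of_pos hp] at this
    refine this.congr fun n => ?_
    simp only [Function.comp_apply]
    rw [← ENNReal.rpow_mul, one_div_mul_cancel hp.ne', ENNReal.rpow_one]

theorem aestronglyMeasurable_gquot {u : EuclideanSpace ℝ (Fin N) → ℝ}
    (hu : AEStronglyMeasurable u volume) : AEStronglyMeasurable (gquot s p u) volume := by
  rw [Measure.volume_eq_prod]
  have h : AEMeasurable (fun z : EuclideanSpace ℝ (Fin N) × EuclideanSpace ℝ (Fin N) =>
      ‖z.1 - z.2‖ ^ (((N : ℝ) + s * p) / p)) (volume.prod volume) := by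
    fun_prop
  exact ((hu.comp_fst.sub hu.comp_snd).aemeasurable.div h).aestronglyMeasurable

/-- In polar coordinates the integrand is at most a multiple of `r^(p - sp - 1)` near `0`,
integrable because `s < 1`, and of `r^(-sp - 1)` at infinity, integrable because `s > 0`. -/
theorem lintegral_radial_min_lt_top (hN : 0 < N) (hs0 : 0 < s) (hs1 : s < 1) (hp : 1 < p)
    (L M : ℝ) (hL : 0 ≤ L) (hM : 0 ≤ M) :
    ∫⁻ h : EuclideanSpace ℝ (Fin N),
      ENNReal.ofReal (min M (L * ‖h‖) ^ p / ‖h‖ ^ ((N : ℝ) + s * p)) < ∞ := by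
  have : Nonempty (Fin N) := ⟨⟨0, hN⟩⟩
  have : Nontrivial (EuclideanSpace ℝ (Fin N)) := inferInstance
  have hp0 : 0 < p := by linarith
  let f : ℝ → ℝ := fun r => min M (L * r) ^ p / r ^ ((N : ℝ) + s * p)
  have hf : Measurable f := by fun_prop
  have hpow {r : ℝ} (hr : 0 < r) (c : ℝ) (e : ℝ) :
      r ^ (N - 1) * (c * r ^ e / r ^ ((N : ℝ) + s * p)) = c * r ^ (e - s * p - 1) := by
    have h1 : r ^ (N - 1) = r ^ ((N : ℝ) - 1) := by
      rw [← Real.rpow_natCast, Nat.cast_sub hN, Nat.cast_one]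
    rw [h1, mul_div_assoc, ← Real.rpow_sub hr, mul_left_comm, ← Real.rpow_add hr]
    congr 2
    ring
  have key : Integrable (fun h : EuclideanSpace ℝ (Fin N) => f ‖h‖) volume := by
    rw [integrable_fun_norm_addHaar volume]
    simp only [finrank_euclideanSpace, Fintype.card_fin, smul_eq_mul]
    rw [← Set.Ioc_union_Ioi_eq_Ioi (zero_le_one (α := ℝ)), integrableOn_union]
    constructor
    · have h0 : IntegrableOn (fun r : ℝ => L ^ p * r ^ (p - s * p - 1)) (Set.Ioc 0 1) := by
        have := intervalIntegral.intervalIntegrable_rpow' (a := 0) (b := 1)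
          (r := p - s * p - 1) (by nlinarith)
        rw [intervalIntegrable_iff_integrableOn_Ioc_of_le zero_le_one] at this
        exact this.const_mul _
      refine Integrable.mono' h0 (by fun_prop) ?_
      refine (ae_restrict_iff' measurableSet_Ioc).2 (ae_of_all _ fun r hr => ?_)
      have hr0 : 0 < r := hr.1
      have hm : 0 ≤ min M (L * r) := le_min hM (by positivity)
      rw [Real.norm_of_nonneg (by positivity), ← hpow hr0]
      refine mul_le_mul_of_nonneg_left ?_ (by positivity)
      refine div_le_div_of_nonneg_right ?_ (by positivity)
      rw [← Real.mul_rpow hL hr0.le]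
      exact Real.rpow_le_rpow hm (min_le_right _ _) hp0.le
    · have h0 : IntegrableOn (fun r : ℝ => M ^ p * r ^ (0 - s * p - 1)) (Set.Ioi 1) :=
        (integrableOn_Ioi_rpow_of_lt (by nlinarith) zero_lt_one).const_mul _
      refine Integrable.mono' h0 (by fun_prop) ?_
      refine (ae_restrict_iff' measurableSet_Ioi).2 (ae_of_all _ fun r hr => ?_)
      have hr0 : 0 < r := zero_lt_one.trans hr
      have hm : 0 ≤ min M (L * r) := le_min hM (by positivity)
      rw [Real.norm_of_nonneg (by positivity), ← hpow hr0]
      refine mul_le_mul_of_nonneg_left ?_ (by positivity)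
      refine div_le_div_of_nonneg_right ?_ (by positivity)
      rw [Real.rpow_zero, mul_one]
      exact Real.rpow_le_rpow hm (min_le_left _ _) hp0.le
  exact (hasFiniteIntegral_iff_ofReal (ae_of_all _ fun h => by
    have : 0 ≤ min M (L * ‖h‖) := le_min hM (by positivity)
    positivity)).1 key.2

/-- A compactly supported Lipschitz function has finite energy. -/
theorem energy_lt_top_of_lipschitz (hN : 0 < N) (hs0 : 0 < s) (hs1 : s < 1) (hp : 1 < p)
    {φ : EuclideanSpace ℝ (Fin N) → ℝ} {L : NNReal} (hL : LipschitzWith L φ)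
    (hφ : HasCompactSupport φ) : energy s p φ < ∞ := by
  obtain ⟨M, hM⟩ := hφ.exists_bound_of_continuous hL.continuous
  have hp0 : 0 < p := by linarith
  have hM0 : 0 ≤ M := (norm_nonneg _).trans (hM 0)
  let K := tsupport φ
  have hK : MeasurableSet K := (isClosed_tsupport φ).measurableSet
  let F : EuclideanSpace ℝ (Fin N) → ℝ≥0∞ := fun h =>
    ENNReal.ofReal (min (2 * M) (L * ‖h‖) ^ p / ‖h‖ ^ ((N : ℝ) + s * p))
  have hF : Measurable F := by fun_prop
  have hF_top : ∫⁻ h, F h < ∞ :=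
    lintegral_radial_min_lt_top hN hs0 hs1 hp L (2 * M) L.2 (by positivity)
  let k : EuclideanSpace ℝ (Fin N) → ℝ≥0∞ := K.indicator 1
  have hk : Measurable k := measurable_one.indicator hK
  have hk_int : ∫⁻ x, k x = volume K := by
    simp [k, lintegral_indicator hK]
  -- The difference vanishes unless one of the two points lies in the support, so the double
  -- integral splits into two products of a finite volume and a radial integral.
  have hle (z : EuclideanSpace ℝ (Fin N) × EuclideanSpace ℝ (Fin N)) :
      ENNReal.ofReal (|φ z.1 - φ z.2| ^ p / ‖z.1 - z.2‖ ^ ((N : ℝ) + s * p)) ≤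
        k z.1 * F (z.1 - z.2) + k z.2 * F (z.1 - z.2) := by
    have hb : ENNReal.ofReal (|φ z.1 - φ z.2| ^ p / ‖z.1 - z.2‖ ^ ((N : ℝ) + s * p)) ≤
        F (z.1 - z.2) := by
      refine ENNReal.ofReal_le_ofReal ?_
      gcongr
      refine le_min ?_ ?_
      · have h1 := hM z.1
        have h2 := hM z.2
        have := abs_sub (φ z.1) (φ z.2)
        simp only [Real.norm_eq_abs] at h1 h2
        linarith
      · simpa [Real.dist_eq, dist_eq_norm] using hL.dist_le_mul z.1 z.2
    by_cases h1 : z.1 ∈ K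
    · refine le_add_right ?_
      simpa [k, h1] using hb
    by_cases h2 : z.2 ∈ K
    · refine le_add_left ?_
      simpa [k, h2] using hb
    simp [image_eq_zero_of_notMem_tsupport h1, image_eq_zero_of_notMem_tsupport h2, hp0.ne']
  have hfin : (volume K) * ∫⁻ h, F h < ∞ := ENNReal.mul_lt_top hφ.measure_lt_top hF_top
  calc energy s p φ ≤ ∫⁻ z : EuclideanSpace ℝ (Fin N) × EuclideanSpace ℝ (Fin N),
        (k z.1 * F (z.1 - z.2) + k z.2 * F (z.1 - z.2)) := lintegral_mono hle
    _ = (∫⁻ z : EuclideanSpace ℝ (Fin N) × EuclideanSpace ℝ (Fin N), k z.1 * F (z.1 - z.2)) +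
        ∫⁻ z : EuclideanSpace ℝ (Fin N) × EuclideanSpace ℝ (Fin N), k z.2 * F (z.1 - z.2) :=
        lintegral_add_left (by fun_prop) _
    _ = volume K * (∫⁻ h, F h) + volume K * ∫⁻ h, F h := by
        rw [Measure.volume_eq_prod]
        congr 1
        · rw [lintegral_prod _ (by fun_prop)]
          simp only
          conv_lhs =>
            enter [2, x]
            rw [lintegral_const_mul _ (by fun_prop), lintegral_sub_left_eq_self]
          rw [lintegral_mul_const _ hk, hk_int]
        · rw [lintegral_prod_symm _ (by fun_prop)]
          simp only
          conv_lhs =>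
            enter [2, x]
            rw [lintegral_const_mul _ (by fun_prop), lintegral_sub_right_eq_self]
          rw [lintegral_mul_const _ hk, hk_int]
    _ < ∞ := ENNReal.add_lt_top.2 ⟨hfin, hfin⟩

theorem MemD.memLp_gquot (hN : 0 < N) (hs0 : 0 < s) (hs1 : s < 1) (hp : 1 < p)
    {u : EuclideanSpace ℝ (Fin N) → ℝ} (hu : MemD s p u) :
    MemLp (gquot s p u) (ENNReal.ofReal p) volume := by
  have hp0 : 0 < p := by linarith
  obtain ⟨hum, φ, hφ, hE, -⟩ := hu
  refine ⟨aestronglyMeasurable_gquot hum, ?_⟩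
  obtain ⟨n, hn⟩ := (hE.eventually_lt_const one_pos).exists
  obtain ⟨L, hL⟩ := (hφ n).1.lipschitzWith_of_hasCompactSupport (hφ n).2 one_ne_zero
  have h1 : eLpNorm (gquot s p (φ n)) (ENNReal.ofReal p) volume < ∞ := by
    rw [eLpNorm_gquot hp0]
    exact ENNReal.rpow_lt_top_of_nonneg (by positivity)
      (energy_lt_top_of_lipschitz hN hs0 hs1 hp hL (hφ n).2).ne
  have h2 : eLpNorm (gquot s p (φ n) - gquot s p u) (ENNReal.ofReal p) volume < ∞ := by
    rw [← gquot_sub, eLpNorm_gquot hp0]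
    exact ENNReal.rpow_lt_top_of_nonneg (by positivity) (hn.trans ENNReal.one_lt_top).ne
  have hm := aestronglyMeasurable_gquot (s := s) (p := p)
    (hφ n).1.continuous.aestronglyMeasurable
  have := (MemLp.sub ⟨hm, h1⟩ ⟨hm.sub (aestronglyMeasurable_gquot hum), h2⟩).2
  simpa using this

theorem MemD.energy_lt_top (hN : 0 < N) (hs0 : 0 < s) (hs1 : s < 1) (hp : 1 < p)
    {u : EuclideanSpace ℝ (Fin N) → ℝ} (hu : MemD s p u) : energy s p u < ∞ := by
  have hp0 : 0 < p := by linarith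
  have := (hu.memLp_gquot hN hs0 hs1 hp).2
  rw [eLpNorm_gquot hp0] at this
  exact (ENNReal.rpow_lt_top_iff_of_pos (by positivity)).1 this

theorem MemD.memLp_critExp {u : EuclideanSpace ℝ (Fin N) → ℝ} (hu : MemD s p u) :
    MemLp u (critExp N s p) volume := by
  obtain ⟨hum, φ, hφ, -, hE⟩ := hu
  refine ⟨hum, ?_⟩
  obtain ⟨n, hn⟩ := (hE.eventually_lt_const one_pos).exists
  have h1 : MemLp (φ n) (critExp N s p) volume :=
    (hφ n).1.continuous.memLp_of_hasCompactSupport (hφ n).2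
  have := (h1.sub ⟨h1.1.sub hum, hn.trans ENNReal.one_lt_top⟩).2
  simpa using this

/-- `C^1_c` functions belong to `D^{s,p}`. -/
theorem memD_of_contDiff (hp : 0 < p) {φ : EuclideanSpace ℝ (Fin N) → ℝ} (h : ContDiff ℝ 1 φ)
    (hc : HasCompactSupport φ) : MemD s p φ := by
  refine ⟨h.continuous.aestronglyMeasurable, fun _ => φ, fun _ => ⟨h, hc⟩, ?_, ?_⟩
  · simp [energy, hp.ne']
  · simp

theorem tendsto_eLpNorm_const_mul_abs_add_abs {α : Type*} [MeasurableSpace α] {μ : Measure α}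
    {q : ℝ≥0∞} (hq : 1 ≤ q) (L : ℝ) {f g : ℕ → α → ℝ} (hfm : ∀ n, AEStronglyMeasurable (f n) μ)
    (hgm : ∀ n, AEStronglyMeasurable (g n) μ)
    (hf : Tendsto (fun n => eLpNorm (f n) q μ) atTop (𝓝 0))
    (hg : Tendsto (fun n => eLpNorm (g n) q μ) atTop (𝓝 0)) :
    Tendsto (fun n => eLpNorm (fun x => L * (|f n x| + |g n x|)) q μ) atTop (𝓝 0) := by
  have h0 := ENNReal.Tendsto.const_mul (a := ‖L‖ₑ) (by simpa using hf.add hg)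
    (Or.inr enorm_ne_top)
  rw [mul_zero] at h0
  refine tendsto_of_tendsto_of_tendsto_of_le_of_le tendsto_const_nhds h0
    (fun n => zero_le) fun n => ?_
  change eLpNorm (L • ((fun x => ‖f n x‖) + fun x => ‖g n x‖)) q μ ≤ _
  rw [eLpNorm_const_smul]
  refine mul_le_mul_right ?_ _
  refine (eLpNorm_add_le (hfm _).norm (hgm _).norm hq).trans_eq ?_
  rw [eLpNorm_norm, eLpNorm_norm]

/-- `D^{s,p}` is stable under composition with Lipschitz functions of two variables. -/
theorem MemD.comp_lipschitz (hN : 0 < N) (hs0 : 0 < s) (hs1 : s < 1) (hp : 1 < p)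
    (hsp : s * p < N) {u v : EuclideanSpace ℝ (Fin N) → ℝ} (hu : MemD s p u) (hv : MemD s p v)
    {T : ℝ × ℝ → ℝ} {L : NNReal} (hT : LipschitzWith L T) (hT0 : T 0 = 0) :
    MemD s p (fun x => T (u x, v x)) := by
  have hp0 : 0 < p := by linarith
  have hGu := hu.memLp_gquot hN hs0 hs1 hp
  have hGv := hv.memLp_gquot hN hs0 hs1 hp
  have hLu := hu.memLp_critExp
  have hLv := hv.memLp_critExp
  obtain ⟨hum, φ, hφ, hφE, hφL⟩ := hu
  obtain ⟨hvm, ψ, hψ, hψE, hψL⟩ := hv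
  have hq : 1 ≤ (N : ℝ) * p / ((N : ℝ) - s * p) := by
    rw [le_div_iff₀ (by linarith)]
    nlinarith
  have hcrit : critExp N s p ≠ 0 := by
    simp only [critExp, ne_eq, ENNReal.ofReal_eq_zero, not_le]
    linarith
  have hφm (n : ℕ) : AEStronglyMeasurable (φ n) volume := (hφ n).1.continuous.aestronglyMeasurable
  have hψm (n : ℕ) : AEStronglyMeasurable (ψ n) volume := (hψ n).1.continuous.aestronglyMeasurable
  obtain ⟨a, ha, hφa⟩ :=
    (tendstoInMeasure_of_tendsto_eLpNorm hcrit hφm hum hφL).exists_seq_tendsto_ae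
  -- A further subsequence is extracted, so that along `a ∘ b` both approximations converge a.e.
  obtain ⟨b, hb, hψb⟩ := (tendstoInMeasure_of_tendsto_eLpNorm hcrit (fun n => hψm (a n)) hvm
    (hψL.comp ha.tendsto_atTop)).exists_seq_tendsto_ae
  have hab : Tendsto (fun n => a (b n)) atTop atTop := ha.tendsto_atTop.comp hb.tendsto_atTop
  obtain ⟨S, hS, hST⟩ := exists_contDiff_lipschitz_approx hT hT0
  let w : EuclideanSpace ℝ (Fin N) → ℝ := fun x => T (u x, v x)
  let χ : ℕ → EuclideanSpace ℝ (Fin N) → ℝ := fun n x => S n (φ (a (b n)) x, ψ (a (b n)) x)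
  have hwm : AEStronglyMeasurable w volume :=
    hT.continuous.comp_aestronglyMeasurable (hum.prodMk hvm)
  have hχ (n : ℕ) : ContDiff ℝ 1 (χ n) ∧ HasCompactSupport (χ n) := by
    refine ⟨(hS n).1.comp ((hφ _).1.prodMk (hψ _).1), ?_⟩
    exact (hφ _).2.comp₂_left (hψ _).2 (m := fun a b => S n (a, b)) (hS n).2.2
  have hχm (n : ℕ) : AEStronglyMeasurable (χ n) volume := (hχ n).1.continuous.aestronglyMeasurable
  have hlim : ∀ᵐ x ∂(volume : Measure (EuclideanSpace ℝ (Fin N))),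
      Tendsto (fun n => χ n x) atTop (𝓝 (w x)) := by
    filter_upwards [hφa, hψb] with x hx hy
    have h1 : Tendsto (fun n => (φ (a (b n)) x, ψ (a (b n)) x)) atTop (𝓝 (u x, v x)) :=
      (hx.comp hb.tendsto_atTop).prodMk_nhds hy
    have h2 : Tendsto (fun n => L * dist (φ (a (b n)) x, ψ (a (b n)) x) (u x, v x)) atTop (𝓝 0) := by
      simpa using (tendsto_iff_dist_tendsto_zero.1 h1).const_mul (L : ℝ)
    -- Since the `S n` share the Lipschitz constant `L`, moving the argument to `(u x, v x)` costs a
    -- vanishing error, and pointwise convergence of `S n` suffices.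
    refine (tendsto_iff_of_dist ?_).1 (hST (u x, v x))
    refine squeeze_zero (fun n => dist_nonneg) (fun n => ?_) h2
    rw [dist_comm]
    exact (hS n).2.1.dist_le_mul _ _
  have hdist (a b c d : ℝ) : dist (a, b) (c, d) ≤ |a - c| + |b - d| := by
    rw [Prod.dist_eq, Real.dist_eq, Real.dist_eq]
    exact max_le_add_of_nonneg (abs_nonneg _) (abs_nonneg _)
  -- Primed quantities belong to the limits, unprimed ones to the approximants. The bound has the
  -- form required by `tendsto_eLpNorm_of_dominated`: a fixed function plus one that tends to `0` in
  -- norm.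
  have habs {a a' b b' : ℝ} (d d' : ℝ) (h : |d - d'| ≤ L * (|a| + |b|) + L * (|a'| + |b'|)) :
      |d - d'| ≤ 2 * L * (|a'| + |b'|) + |L * (|a - a'| + |b - b'|)| := by
    have h1 : |a| ≤ |a'| + |a - a'| := by
      have := abs_sub_abs_le_abs_sub a a'
      linarith
    have h2 : |b| ≤ |b'| + |b - b'| := by
      have := abs_sub_abs_le_abs_sub b b'
      linarith
    have h3 : L * (|a| + |b|) ≤ L * ((|a'| + |a - a'|) + (|b'| + |b - b'|)) := by gcongr
    refine h.trans ?_
    refine le_trans ?_ (add_le_add_right (le_abs_self _) _)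
    linarith
  refine ⟨hwm, χ, hχ, ?_, ?_⟩
  · rw [tendsto_energy_zero_iff hp0]
    simp only [gquot_sub]
    rw [tendsto_energy_zero_iff hp0] at hφE hψE
    have hGum := aestronglyMeasurable_gquot (s := s) (p := p) hum
    have hGvm := aestronglyMeasurable_gquot (s := s) (p := p) hvm
    refine tendsto_eLpNorm_of_dominated hp.le
      (f₀ := fun z => 2 * L * (|gquot s p u z| + |gquot s p v z|))
      (f := fun n z => L * (|gquot s p (φ (a (b n)) - u) z| + |gquot s p (ψ (a (b n)) - v) z|))
      (fun n => aestronglyMeasurable_gquot (hχm n)) (aestronglyMeasurable_gquot hwm)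
      (fun n => ((aestronglyMeasurable_gquot ((hφm _).sub hum)).norm.add
        (aestronglyMeasurable_gquot ((hψm _).sub hvm)).norm).const_mul _)
      ((hGu.norm.add hGv.norm).const_mul _) ?_ ?_ ?_
    · rw [Measure.volume_eq_prod]
      filter_upwards [Measure.quasiMeasurePreserving_fst.ae hlim,
        Measure.quasiMeasurePreserving_snd.ae hlim] with z h1 h2
      exact (h1.sub h2).div_const _
    · refine fun n => ae_of_all _ fun z => ?_
      simp only [gquot_sub, Pi.sub_apply]
      refine habs _ _ ?_
      have hd : 0 ≤ ‖z.1 - z.2‖ ^ (((N : ℝ) + s * p) / p) := by positivity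
      refine (abs_sub _ _).trans (add_le_add ?_ ?_)
      · simp only [gquot, abs_div, ← add_div, ← mul_div_assoc]
        gcongr
        have := ((hS n).2.1.dist_le_mul (φ (a (b n)) z.1, ψ (a (b n)) z.1)
          (φ (a (b n)) z.2, ψ (a (b n)) z.2)).trans
          (mul_le_mul_of_nonneg_left (hdist _ _ _ _) L.2)
        rwa [Real.dist_eq] at this
      · simp only [gquot, abs_div, ← add_div, ← mul_div_assoc]
        gcongr
        have := (hT.dist_le_mul (u z.1, v z.1) (u z.2, v z.2)).trans
          (mul_le_mul_of_nonneg_left (hdist _ _ _ _) L.2)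
        rwa [Real.dist_eq] at this
    · exact tendsto_eLpNorm_const_mul_abs_add_abs (by simpa using hp.le) L
        (fun n => aestronglyMeasurable_gquot ((hφm _).sub hum))
        (fun n => aestronglyMeasurable_gquot ((hψm _).sub hvm)) (hφE.comp hab) (hψE.comp hab)
  · refine tendsto_eLpNorm_of_dominated hq (f₀ := fun z => 2 * L * (|u z| + |v z|))
      (f := fun n z => L * (|(φ (a (b n)) - u) z| + |(ψ (a (b n)) - v) z|))
      hχm hwm (fun n => (((hφm _).sub hum).norm.add ((hψm _).sub hvm).norm).const_mul _)
      ((hLu.norm.add hLv.norm).const_mul _) hlim ?_ ?_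
    · refine fun n => ae_of_all _ fun x => ?_
      refine habs _ _ ?_
      refine (abs_sub _ _).trans (add_le_add ?_ ?_)
      · have := ((hS n).2.1.dist_le_mul (φ (a (b n)) x, ψ (a (b n)) x) (0, 0)).trans
          (mul_le_mul_of_nonneg_left (hdist _ _ _ _) L.2)
        rw [Real.dist_eq, show S n (0, 0) = 0 from (hS n).2.2] at this
        simpa using this
      · have := (hT.dist_le_mul (u x, v x) (0, 0)).trans
          (mul_le_mul_of_nonneg_left (hdist _ _ _ _) L.2)
        rw [Real.dist_eq, show T (0, 0) = 0 from hT0] at this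
        simpa using this
    · exact tendsto_eLpNorm_const_mul_abs_add_abs (by simpa using hq) L
        (fun n => (hφm _).sub hum) (fun n => (hψm _).sub hvm) (hφL.comp hab) (hψL.comp hab)

/-! ### The `ℓ^p` norm on pairs and its strict convexity -/

/-- The `ℓ^p` norm of a pair of real numbers. -/
noncomputable def lpPair (p : ℝ) (a : ℝ × ℝ) : ℝ := (|a.1| ^ p + |a.2| ^ p) ^ (1 / p)

theorem norm_toLp_pair {p : ℝ} (hp : 0 < p) (a : ℝ × ℝ) :
    ‖WithLp.toLp (ENNReal.ofReal p) a‖ = lpPair p a := by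
  rw [WithLp.prod_norm_eq_add (by simpa [hp.le] using hp), ENNReal.toReal_ofReal hp.le]
  rfl

theorem lpPair_nonneg (p : ℝ) (a : ℝ × ℝ) : 0 ≤ lpPair p a := by
  unfold lpPair
  positivity

theorem lpPair_rpow {p : ℝ} (hp : 0 < p) (a : ℝ × ℝ) :
    lpPair p a ^ p = |a.1| ^ p + |a.2| ^ p := by
  rw [lpPair, ← Real.rpow_mul (by positivity), one_div_mul_cancel hp.ne', Real.rpow_one]

theorem lpPair_zero {p : ℝ} (hp : 0 < p) : lpPair p 0 = 0 := by
  simp [lpPair, hp.ne']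

theorem strictConvexSpace_withLp_prod {p : ℝ} (hp : 1 < p) [Fact (1 ≤ ENNReal.ofReal p)] :
    StrictConvexSpace ℝ (WithLp (ENNReal.ofReal p) (ℝ × ℝ)) := by
  have hp0 : 0 < p := by linarith
  have hconv := (strictConvexOn_rpow hp)
  have hle (a b : ℝ) : |(a + b) / 2| ^ p ≤ (|a| ^ p + |b| ^ p) / 2 := by
    have h1 : |(a + b) / 2| ≤ (1 / 2 : ℝ) • |a| + (1 / 2 : ℝ) • |b| := by
      rw [abs_div, abs_two]
      have := abs_add_le a b
      simp only [smul_eq_mul]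
      linarith
    have h2 := hconv.convexOn.2 (abs_nonneg a) (abs_nonneg b)
      (by norm_num : (0 : ℝ) ≤ 1 / 2) (by norm_num : (0 : ℝ) ≤ 1 / 2) (by norm_num)
    refine (Real.rpow_le_rpow (abs_nonneg _) h1 hp0.le).trans (h2.trans_eq ?_)
    simp only [smul_eq_mul]
    ring
  have hlt {a b : ℝ} (hab : a ≠ b) : |(a + b) / 2| ^ p < (|a| ^ p + |b| ^ p) / 2 := by
    -- If `|a| = |b|` with `a ≠ b`, the midpoint is `0`; otherwise strict convexity of `r ↦ r^p`
    -- applies to the absolute values.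
    rcases eq_or_ne |a| |b| with h | h
    · have hb : a = -b := (abs_eq_abs.1 h).resolve_left hab
      have hb0 : b ≠ 0 := by
        rintro rfl
        exact hab (by simpa using hb)
      subst hb
      have : 0 < |b| ^ p := Real.rpow_pos_of_pos (abs_pos.2 hb0) _
      simpa [hp0.ne'] using this
    · have h1 : |(a + b) / 2| ≤ (1 / 2 : ℝ) • |a| + (1 / 2 : ℝ) • |b| := by
        rw [abs_div, abs_two]
        have := abs_add_le a b
        simp only [smul_eq_mul]
        linarith
      have h2 := hconv.2 (abs_nonneg a) (abs_nonneg b) h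
        (by norm_num : (0 : ℝ) < 1 / 2) (by norm_num : (0 : ℝ) < 1 / 2) (by norm_num)
      refine (Real.rpow_le_rpow (abs_nonneg _) h1 hp0.le).trans_lt (h2.trans_eq ?_)
      simp only [smul_eq_mul]
      ring
  refine StrictConvexSpace.of_norm_add_ne_two fun x y hx hy hne h => ?_
  have key (x : WithLp (ENNReal.ofReal p) (ℝ × ℝ)) : |x.fst| ^ p + |x.snd| ^ p = ‖x‖ ^ p := by
    have := norm_toLp_pair hp0 (WithLp.ofLp x)
    rw [WithLp.toLp_ofLp] at this
    rw [this, lpPair_rpow hp0]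
    rfl
  have hx' := key x
  have hy' := key y
  have hxy := key ((1 / 2 : ℝ) • (x + y))
  rw [norm_smul, h] at hxy
  rw [hx, Real.one_rpow] at hx'
  rw [hy, Real.one_rpow] at hy'
  have e1 : ((1 / 2 : ℝ) • (x + y)).fst = (x.fst + y.fst) / 2 := by
    simp only [WithLp.smul_fst, WithLp.add_fst, smul_eq_mul]
    ring
  have e2 : ((1 / 2 : ℝ) • (x + y)).snd = (x.snd + y.snd) / 2 := by
    simp only [WithLp.smul_snd, WithLp.add_snd, smul_eq_mul]
    ring
  rw [e1, e2, show ‖(1 / 2 : ℝ)‖ * 2 = 1 by norm_num, Real.one_rpow] at hxy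
  -- The midpoint of two unit vectors would have norm `1`, yet midpoint convexity is strict in
  -- whichever coordinate differs.
  by_cases h1 : x.fst = y.fst
  · have h2 : x.snd ≠ y.snd := fun h2 => hne (by
      apply (WithLp.equiv _ _).injective
      exact Prod.ext h1 h2)
    linarith [hle x.fst y.fst, hlt h2]
  · linarith [hle x.snd y.snd, hlt h1]

theorem abs_lpPair_sub_le {p : ℝ} (hp : 1 ≤ p) (a b : ℝ × ℝ) :
    |lpPair p a - lpPair p b| ≤ lpPair p (a - b) := by
  have hp0 : 0 < p := by linarith
  have : Fact (1 ≤ ENNReal.ofReal p) := ⟨by simpa using hp⟩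
  simp only [← norm_toLp_pair hp0, WithLp.toLp_sub]
  exact abs_norm_sub_norm_le _ _

/-- In a strictly convex space, equality in the reverse triangle inequality forces the vectors onto
a common ray. The cross-product form avoids division and covers zero vectors. -/
theorem mul_eq_mul_of_abs_lpPair_sub_eq {p : ℝ} (hp : 1 < p) {a b : ℝ × ℝ}
    (h : |lpPair p a - lpPair p b| = lpPair p (a - b)) : a.1 * b.2 = b.1 * a.2 := by
  have hp0 : 0 < p := by linarith
  have : Fact (1 ≤ ENNReal.ofReal p) := ⟨by simpa using hp.le⟩
  have := strictConvexSpace_withLp_prod hp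
  simp only [← norm_toLp_pair hp0, WithLp.toLp_sub] at h
  rcases sameRay_iff_norm_sub.2 h.symm with h | h | ⟨r, t, hr, -, h⟩
  · have h1 : a = 0 := by simpa using h
    simp [h1]
  · have h1 : b = 0 := by simpa using h
    simp [h1]
  · have h1 : r • a = t • b := by
      have := congrArg WithLp.ofLp h
      simpa using this
    have e1 : r * a.1 = t * b.1 := congrArg Prod.fst h1
    have e2 : r * a.2 = t * b.2 := congrArg Prod.snd h1
    refine mul_left_cancel₀ hr.ne' ?_
    linear_combination b.2 * e1 - b.1 * e2

theorem lipschitzWith_lpPair {p : ℝ} (hp : 1 ≤ p) : LipschitzWith 2 (lpPair p) := by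
  refine LipschitzWith.of_dist_le_mul fun a b => ?_
  have hp0 : 0 < p := by linarith
  rw [Real.dist_eq]
  refine (abs_lpPair_sub_le hp a b).trans ?_
  have h1 : |(a - b).1| ≤ dist a b := le_max_left _ _
  have h2 : |(a - b).2| ≤ dist a b := le_max_right _ _
  have h3 : lpPair p (a - b) ^ p ≤ (2 * dist a b) ^ p := by
    rw [lpPair_rpow hp0, Real.mul_rpow zero_le_two dist_nonneg]
    -- The constant `2` is not sharp (`2^(1/p)` is), but keeps the Lipschitz constant free of `p`.
    have h4 : (2 : ℝ) ≤ 2 ^ p := by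
      simpa using Real.rpow_le_rpow_of_exponent_le one_le_two hp
    have h5 := Real.rpow_le_rpow (abs_nonneg _) h1 hp0.le
    have h6 := Real.rpow_le_rpow (abs_nonneg _) h2 hp0.le
    have h7 : 0 ≤ dist a b ^ p := by positivity
    nlinarith
  exact (Real.rpow_le_rpow_iff (lpPair_nonneg _ _) (by positivity) hp0).1 h3

/-! ### The weak form, its integrability, and functions of zero energy -/

theorem abs_rpow_sub_two_mul_self {p : ℝ} (hp : 1 < p) (a : ℝ) :
    |(|a| ^ (p - 2) * a)| = |a| ^ (p - 1) := by
  rw [abs_mul, abs_of_nonneg (Real.rpow_nonneg (abs_nonneg _) _)]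
  rcases eq_or_ne a 0 with rfl | ha
  · rw [abs_zero, mul_zero, Real.zero_rpow (by linarith)]
  · rw [← Real.rpow_add_one (abs_pos.2 ha).ne']
    congr 1
    ring

theorem abs_rpow_sub_two_mul_of_nonneg {p : ℝ} (hp : 1 < p) {a : ℝ} (ha : 0 ≤ a) :
    |a| ^ (p - 2) * a = |a| ^ (p - 1) := by
  rw [← abs_rpow_sub_two_mul_self hp, abs_of_nonneg (a := |a| ^ (p - 2) * a) (by positivity)]

theorem abs_rpow_sub_two_mul_of_nonpos {p : ℝ} (hp : 1 < p) {a : ℝ} (ha : a ≤ 0) :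
    |a| ^ (p - 2) * a = -|a| ^ (p - 1) := by
  have := abs_rpow_sub_two_mul_of_nonneg hp (neg_nonneg.2 ha)
  rw [abs_neg] at this
  linarith

theorem abs_rpow_sub_two_mul_mul_self {p : ℝ} (hp : 1 < p) (a : ℝ) :
    |a| ^ (p - 2) * a * a = |a| ^ p := by
  rcases eq_or_ne a 0 with rfl | ha
  · rw [mul_zero, abs_zero, Real.zero_rpow (by linarith)]
  · rw [mul_assoc, ← abs_mul_abs_self a, ← mul_assoc, ← Real.rpow_add_one (abs_pos.2 ha).ne',
      ← Real.rpow_add_one (abs_pos.2 ha).ne']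
    congr 1
    ring

theorem rpow_sub_one_mul_le {p a b : ℝ} (hp : 1 < p) (ha : 0 ≤ a) (hb : 0 ≤ b) :
    a ^ (p - 1) * b ≤ a ^ p + b ^ p := by
  have h (x : ℝ) (hx : 0 ≤ x) : x ^ (p - 1) * x = x ^ p := by
    rcases hx.eq_or_lt with rfl | hx
    · rw [mul_zero, Real.zero_rpow (by linarith)]
    · rw [← Real.rpow_add_one hx.ne', sub_add_cancel]
  rcases le_total a b with hab | hab
  · calc _ ≤ b ^ (p - 1) * b := by gcongr
      _ = b ^ p := h b hb
      _ ≤ _ := le_add_of_nonneg_left (by positivity)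
  · calc _ ≤ a ^ (p - 1) * a := by gcongr
      _ = a ^ p := h a ha
      _ ≤ _ := le_add_of_nonneg_right (by positivity)

theorem form_integrand_eq (hp : 0 < p) (u v : EuclideanSpace ℝ (Fin N) → ℝ)
    (z : EuclideanSpace ℝ (Fin N) × EuclideanSpace ℝ (Fin N)) :
    |u z.1 - u z.2| ^ (p - 2) * (u z.1 - u z.2) * (v z.1 - v z.2)
      / ‖z.1 - z.2‖ ^ ((N : ℝ) + s * p) =
      |gquot s p u z| ^ (p - 2) * gquot s p u z * gquot s p v z := by
  rcases eq_or_ne z.1 z.2 with h | h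
  · simp [gquot, h]
  have hr : 0 < ‖z.1 - z.2‖ := norm_pos_iff.2 (sub_ne_zero.2 h)
  rw [← rpow_div_rpow hp _ hr.le]
  unfold gquot
  set R := ‖z.1 - z.2‖ ^ (((N : ℝ) + s * p) / p)
  have hR : 0 < R := Real.rpow_pos_of_pos hr _
  rw [abs_div, abs_of_pos hR, Real.div_rpow (abs_nonneg _) hR.le]
  have : R ^ p = R ^ (p - 2) * R * R := by
    rw [← Real.rpow_add_one hR.ne', ← Real.rpow_add_one hR.ne']
    congr 1
    ring
  rw [this]
  have := Real.rpow_pos_of_pos hR (p - 2)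
  field_simp

theorem MemLp.integrable_abs_rpow {α : Type*} [MeasurableSpace α] {μ : Measure α} (hp : 0 < p)
    {f : α → ℝ} (hf : MemLp f (ENNReal.ofReal p) μ) : Integrable (fun x => |f x| ^ p) μ := by
  have := hf.integrable_norm_rpow (by simpa using hp) ENNReal.ofReal_ne_top
  simpa [ENNReal.toReal_ofReal hp.le] using this

theorem integrable_rpow_sub_one_mul {α : Type*} [MeasurableSpace α] {μ : Measure α} (hp : 1 < p)
    {f g : α → ℝ} (hf : MemLp f (ENNReal.ofReal p) μ) (hg : MemLp g (ENNReal.ofReal p) μ) :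
    Integrable (fun x => |f x| ^ (p - 1) * |g x|) μ := by
  have hp0 : 0 < p := by linarith
  refine ((MemLp.integrable_abs_rpow hp0 hf).add (MemLp.integrable_abs_rpow hp0 hg)).mono' ?_ ?_
  · exact ((hf.1.norm.aemeasurable.pow_const (p - 1)).mul hg.1.norm.aemeasurable).aestronglyMeasurable
  · refine ae_of_all _ fun x => ?_
    rw [Real.norm_of_nonneg (by positivity)]
    exact rpow_sub_one_mul_le hp (abs_nonneg _) (abs_nonneg _)

theorem integrable_form (hp : 1 < p) {u v : EuclideanSpace ℝ (Fin N) → ℝ}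
    (hu : MemLp (gquot s p u) (ENNReal.ofReal p) volume)
    (hv : MemLp (gquot s p v) (ENNReal.ofReal p) volume) :
    Integrable (fun z => |gquot s p u z| ^ (p - 2) * gquot s p u z * gquot s p v z) volume := by
  refine (integrable_rpow_sub_one_mul hp hu hv).mono' ?_ (ae_of_all _ fun z => ?_)
  · exact (((hu.1.norm.aemeasurable.pow_const (p - 2)).mul hu.1.aemeasurable).mul
      hv.1.aemeasurable).aestronglyMeasurable
  · rw [norm_mul, Real.norm_eq_abs, abs_rpow_sub_two_mul_self hp, Real.norm_eq_abs]

theorem energy_eq_ofReal_integral (hp : 1 < p) {u : EuclideanSpace ℝ (Fin N) → ℝ}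
    (hu : MemLp (gquot s p u) (ENNReal.ofReal p) volume) :
    energy s p u = ENNReal.ofReal
      (∫ z, |gquot s p u z| ^ (p - 2) * gquot s p u z * gquot s p u z) := by
  have hp0 : 0 < p := by linarith
  simp only [abs_rpow_sub_two_mul_mul_self hp]
  rw [ofReal_integral_eq_lintegral_ofReal (MemLp.integrable_abs_rpow hp0 hu)
    (ae_of_all _ fun z => by positivity)]
  simp only [energy, abs_gquot_rpow hp0]

/-- A function of zero energy in the critical Lebesgue space vanishes. -/
theorem MemD.ae_eq_zero_of_energy_eq_zero (hN : 0 < N) (hp : 1 < p) (hsp : s * p < N)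
    {u : EuclideanSpace ℝ (Fin N) → ℝ} (hu : MemD s p u) (h : energy s p u = 0) :
    u =ᵐ[volume] 0 := by
  have hp0 : 0 < p := by linarith
  have : Nonempty (Fin N) := ⟨⟨0, hN⟩⟩
  have hG : eLpNorm (gquot s p u) (ENNReal.ofReal p) volume = 0 := by
    rw [eLpNorm_gquot hp0, h, ENNReal.zero_rpow_of_pos (by positivity)]
  rw [eLpNorm_eq_zero_iff (aestronglyMeasurable_gquot hu.1) (by simpa using hp0),
    Measure.volume_eq_prod] at hG
  -- By Fubini `u` is a.e. constant, and the only constant with finite critical norm on a space of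
  -- infinite measure is `0`.
  have hc : ∀ᵐ x ∂(volume : Measure (EuclideanSpace ℝ (Fin N))), ∀ᵐ y, u y = u x := by
    filter_upwards [Measure.ae_ae_of_ae_prod hG] with x hx
    filter_upwards [hx] with y hy
    rcases eq_or_ne x y with rfl | hxy
    · rfl
    have hr : 0 < ‖x - y‖ := norm_pos_iff.2 (sub_ne_zero.2 hxy)
    have := Real.rpow_pos_of_pos hr (((N : ℝ) + s * p) / p)
    simp only [gquot, Pi.zero_apply, div_eq_zero_iff, this.ne', or_false] at hy
    linarith
  obtain ⟨x, hx⟩ := hc.exists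
  have hcrit : critExp N s p ≠ 0 := by
    have : 0 < (N : ℝ) := by exact_mod_cast hN
    simp only [critExp, ne_eq, ENNReal.ofReal_eq_zero, not_le]
    exact div_pos (by positivity) (by linarith)
  have h2 : MemLp (fun _ : EuclideanSpace ℝ (Fin N) => u x) (critExp N s p) volume :=
    hu.memLp_critExp.ae_eq hx
  rw [memLp_const_iff hcrit ENNReal.ofReal_ne_top] at h2
  rcases h2 with h2 | h2
  · filter_upwards [hx] with y hy
    rw [hy, h2, Pi.zero_apply]
  · have : (volume : Measure (EuclideanSpace ℝ (Fin N))) Set.univ = ∞ :=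
      measure_univ_of_isAddLeftInvariant _
    exact absurd this h2.ne

/-! ### Minimizers: proportionality and constant sign -/

/-- `u` attains, up to normalization, the infimum that defines the first eigenvalue. -/
def IsMinimizer (s p : ℝ) (w u : EuclideanSpace ℝ (Fin N) → ℝ) : Prop :=
  MemD s p u ∧ Integrable (fun x => w x * |u x| ^ p) volume ∧ 0 < ∫ x, w x * |u x| ^ p ∧
    energy s p u = firstEigenvalue s p w * ENNReal.ofReal (∫ x, w x * |u x| ^ p)

theorem IsFirstEigenfunction.isMinimizer (hN : 0 < N) (hs0 : 0 < s) (hs1 : s < 1) (hp : 1 < p)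
    (hsp : s * p < N) {w u : EuclideanSpace ℝ (Fin N) → ℝ} (hu : IsFirstEigenfunction s p w u) :
    IsMinimizer s p w u := by
  have hp0 : 0 < p := by linarith
  obtain ⟨hfin, hD, hne, heq⟩ := hu
  obtain ⟨hi, he⟩ := heq u hD
  have e (x : EuclideanSpace ℝ (Fin N)) :
      w x * (|u x| ^ (p - 2) * u x) * u x = w x * |u x| ^ p := by
    rw [mul_assoc, abs_rpow_sub_two_mul_mul_self hp]
  simp only [e, form_integrand_eq hp0] at hi he
  have hE : energy s p u = firstEigenvalue s p w * ENNReal.ofReal (∫ x, w x * |u x| ^ p) := by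
    rw [energy_eq_ofReal_integral hp (hD.memLp_gquot hN hs0 hs1 hp), he,
      ENNReal.ofReal_mul ENNReal.toReal_nonneg, ENNReal.ofReal_toReal hfin]
  refine ⟨hD, hi, ?_, hE⟩
  by_contra hm
  rw [ENNReal.ofReal_of_nonpos (not_lt.1 hm), mul_zero] at hE
  exact hne (hD.ae_eq_zero_of_energy_eq_zero hN hp hsp hE)

theorem IsMinimizer.not_ae_eq_zero (hp : 0 < p) {w u : EuclideanSpace ℝ (Fin N) → ℝ}
    (hu : IsMinimizer s p w u) : ¬ u =ᵐ[volume] 0 := by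
  intro h
  refine hu.2.2.1.ne' (integral_eq_zero_of_ae ?_)
  filter_upwards [h] with x hx
  simp [hx, hp.ne']

theorem energy_const_mul (c : ℝ) (u : EuclideanSpace ℝ (Fin N) → ℝ) :
    energy s p (fun x => c * u x) = ENNReal.ofReal (|c| ^ p) * energy s p u := by
  unfold energy
  rw [← lintegral_const_mul' _ _ ENNReal.ofReal_ne_top]
  refine lintegral_congr fun z => ?_
  rw [← ENNReal.ofReal_mul (by positivity), ← mul_sub, abs_mul,
    Real.mul_rpow (abs_nonneg _) (abs_nonneg _), mul_div_assoc]

theorem firstEigenvalue_mul_le_energy (hN : 0 < N) (hs0 : 0 < s) (hs1 : s < 1) (hp : 1 < p)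
    (hsp : s * p < N) {w v : EuclideanSpace ℝ (Fin N) → ℝ} (hv : MemD s p v)
    (hi : Integrable (fun x => w x * |v x| ^ p) volume) (hm : 0 < ∫ x, w x * |v x| ^ p) :
    firstEigenvalue s p w * ENNReal.ofReal (∫ x, w x * |v x| ^ p) ≤ energy s p v := by
  have hp0 : 0 < p := by linarith
  set m := ∫ x, w x * |v x| ^ p with hmdef
  -- Chosen so that `c^p m = 1`, which makes `c * v` admissible for the infimum.
  let c : ℝ := m ^ (-(1 / p))
  have hc : 0 < c := Real.rpow_pos_of_pos hm _
  have hcp : |c| ^ p = m⁻¹ := by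
    rw [abs_of_pos hc, ← Real.rpow_mul hm.le, neg_mul, one_div_mul_cancel hp0.ne',
      Real.rpow_neg_one]
  have hT : LipschitzWith ⟨c, hc.le⟩ (fun a : ℝ × ℝ => c * a.1) := by
    refine LipschitzWith.of_dist_le_mul fun a b => ?_
    rw [Real.dist_eq, ← mul_sub, abs_mul, abs_of_pos hc]
    exact mul_le_mul_of_nonneg_left (le_max_left (dist a.1 b.1) _) hc.le
  have hD : MemD s p (fun x => c * v x) :=
    hv.comp_lipschitz hN hs0 hs1 hp hsp hv hT (by simp)
  have e (x : EuclideanSpace ℝ (Fin N)) : w x * |c * v x| ^ p = m⁻¹ * (w x * |v x| ^ p) := by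
    rw [abs_mul, Real.mul_rpow (abs_nonneg _) (abs_nonneg _), hcp]
    ring
  have hle : firstEigenvalue s p w ≤ energy s p (fun x => c * v x) := by
    refine iInf₂_le _ ⟨hD, ?_, ?_⟩
    · simp only [e]
      exact hi.const_mul _
    · simp only [e]
      rw [integral_const_mul, ← hmdef, inv_mul_cancel₀ hm.ne']
  rw [energy_const_mul, hcp] at hle
  calc _ ≤ ENNReal.ofReal m⁻¹ * energy s p v * ENNReal.ofReal m := by gcongr
    _ = energy s p v := by
      rw [mul_right_comm, ← ENNReal.ofReal_mul (by positivity), inv_mul_cancel₀ hm.ne',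
        ENNReal.ofReal_one, one_mul]

theorem IsMinimizer.ae_mul_eq_mul (hN : 0 < N) (hs0 : 0 < s) (hs1 : s < 1) (hp : 1 < p)
    (hsp : s * p < N) {w u v : EuclideanSpace ℝ (Fin N) → ℝ} (hu : IsMinimizer s p w u)
    (hv : IsMinimizer s p w v) :
    ∀ᵐ z : EuclideanSpace ℝ (Fin N) × EuclideanSpace ℝ (Fin N),
      u z.1 * v z.2 = u z.2 * v z.1 := by
  have hp0 : 0 < p := by linarith
  obtain ⟨hDu, hiu, hmu, hEu⟩ := hu
  obtain ⟨hDv, hiv, hmv, hEv⟩ := hv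
  let σ : EuclideanSpace ℝ (Fin N) → ℝ := fun x => lpPair p (u x, v x)
  have hσ : MemD s p σ :=
    hDu.comp_lipschitz hN hs0 hs1 hp hsp hDv (lipschitzWith_lpPair hp.le) (lpPair_zero hp0)
  have e : (fun x => w x * |σ x| ^ p) =
      (fun x => w x * |u x| ^ p) + fun x => w x * |v x| ^ p := by
    ext x
    rw [abs_of_nonneg (lpPair_nonneg _ _), lpPair_rpow hp0, mul_add]
    rfl
  have hm : ∫ x, w x * |σ x| ^ p = (∫ x, w x * |u x| ^ p) + ∫ x, w x * |v x| ^ p := by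
    rw [e]
    exact integral_add hiu hiv
  have hσE : energy s p u + energy s p v ≤ energy s p σ := by
    rw [hEu, hEv, ← mul_add, ← ENNReal.ofReal_add hmu.le hmv.le, ← hm]
    refine firstEigenvalue_mul_le_energy hN hs0 hs1 hp hsp hσ ?_ ?_
    · rw [e]
      exact hiu.add hiv
    · rw [hm]
      positivity
  have hpt (x y : EuclideanSpace ℝ (Fin N)) :
      |σ x - σ y| ^ p ≤ |u x - u y| ^ p + |v x - v y| ^ p := by
    have h1 := Real.rpow_le_rpow (abs_nonneg _)
      (abs_lpPair_sub_le hp.le (u x, v x) (u y, v y)) hp0.le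
    rwa [lpPair_rpow hp0] at h1
  let F (f : EuclideanSpace ℝ (Fin N) → ℝ)
      (z : EuclideanSpace ℝ (Fin N) × EuclideanSpace ℝ (Fin N)) : ℝ≥0∞ :=
    ENNReal.ofReal (|f z.1 - f z.2| ^ p / ‖z.1 - z.2‖ ^ ((N : ℝ) + s * p))
  have hFm {f : EuclideanSpace ℝ (Fin N) → ℝ} (hf : MemD s p f) : AEMeasurable (F f) volume := by
    simp only [F, ← abs_gquot_rpow hp0]
    exact ((aestronglyMeasurable_gquot hf.1).norm.aemeasurable.pow_const p).ennreal_ofReal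
  have hadd (z : EuclideanSpace ℝ (Fin N) × EuclideanSpace ℝ (Fin N)) : F u z + F v z =
      ENNReal.ofReal ((|u z.1 - u z.2| ^ p + |v z.1 - v z.2| ^ p) /
        ‖z.1 - z.2‖ ^ ((N : ℝ) + s * p)) := by
    rw [add_div, ENNReal.ofReal_add (by positivity) (by positivity)]
  -- The densities are ordered pointwise and their finite integrals in the opposite sense, so they
  -- agree a.e.
  have hae : F σ =ᵐ[volume] fun z => F u z + F v z := by
    refine ae_eq_of_ae_le_of_lintegral_le (ae_of_all _ fun z => ?_)
      (hσ.energy_lt_top hN hs0 hs1 hp).ne ((hFm hDu).add (hFm hDv)) ?_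
    · simp only [hadd]
      refine ENNReal.ofReal_le_ofReal ?_
      gcongr
      exact hpt _ _
    · rw [lintegral_add_left' (hFm hDu)]
      exact hσE
  filter_upwards [hae] with z hz
  rcases eq_or_ne z.1 z.2 with h | h
  · rw [h]
  have hr : 0 < ‖z.1 - z.2‖ ^ ((N : ℝ) + s * p) :=
    Real.rpow_pos_of_pos (norm_pos_iff.2 (sub_ne_zero.2 h)) _
  rw [hadd, ENNReal.ofReal_eq_ofReal_iff (by positivity) (by positivity),
    div_left_inj' hr.ne'] at hz
  have h2 : |lpPair p (u z.1, v z.1) - lpPair p (u z.2, v z.2)| =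
      lpPair p ((u z.1, v z.1) - (u z.2, v z.2)) := by
    rw [← Real.rpow_left_inj (abs_nonneg _) (lpPair_nonneg _ _) hp0.ne', lpPair_rpow hp0]
    exact hz
  exact mul_eq_mul_of_abs_lpPair_sub_eq hp h2

/-- Two minimizers are proportional. -/
theorem IsMinimizer.exists_const_mul (hN : 0 < N) (hs0 : 0 < s) (hs1 : s < 1) (hp : 1 < p)
    (hsp : s * p < N) {w u v : EuclideanSpace ℝ (Fin N) → ℝ} (hu : IsMinimizer s p w u)
    (hv : IsMinimizer s p w v) : ∃ c : ℝ, c ≠ 0 ∧ ∀ᵐ x ∂volume, u x = c * v x := by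
  have hp0 : 0 < p := by linarith
  have h := hu.ae_mul_eq_mul hN hs0 hs1 hp hsp hv
  rw [Measure.volume_eq_prod] at h
  have hv0 : ∃ᵐ x ∂(volume : Measure (EuclideanSpace ℝ (Fin N))), v x ≠ 0 := fun h0 =>
    hv.not_ae_eq_zero hp0 (h0.mono fun x hx => not_not.1 hx)
  -- Freezing one good point with `v x ≠ 0` turns the cross relation into proportionality with ratio
  -- `u x / v x`.
  obtain ⟨x, hx0, hx⟩ := (hv0.and_eventually (Measure.ae_ae_of_ae_prod h)).exists
  have hc : ∀ᵐ y, u y = u x / v x * v y := by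
    filter_upwards [hx] with y hy
    field_simp
    exact hy.symm
  refine ⟨u x / v x, fun h0 => hu.not_ae_eq_zero hp0 ?_, hc⟩
  filter_upwards [hc] with y hy
  rw [hy, h0, zero_mul, Pi.zero_apply]

theorem IsMinimizer.abs (hN : 0 < N) (hs0 : 0 < s) (hs1 : s < 1) (hp : 1 < p)
    (hsp : s * p < N) {w u : EuclideanSpace ℝ (Fin N) → ℝ} (hu : IsMinimizer s p w u) :
    IsMinimizer s p w (fun x => |u x|) := by
  obtain ⟨hD, hi, hm, hE⟩ := hu
  have hT : LipschitzWith 1 (fun a : ℝ × ℝ => |a.1|) := by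
    refine LipschitzWith.of_dist_le_mul fun a b => ?_
    rw [Real.dist_eq, NNReal.coe_one, one_mul]
    exact (abs_abs_sub_abs_le _ _).trans (le_max_left (dist a.1 b.1) _)
  have hD' : MemD s p (fun x => |u x|) :=
    hD.comp_lipschitz hN hs0 hs1 hp hsp hD hT (by simp)
  have hle := firstEigenvalue_mul_le_energy hN hs0 hs1 hp hsp hD'
    (by simpa only [abs_abs] using hi) (by simpa only [abs_abs] using hm)
  refine ⟨hD', by simpa only [abs_abs] using hi, by simpa only [abs_abs] using hm,
    le_antisymm ?_ hle⟩
  simp only [abs_abs]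
  rw [← hE]
  refine lintegral_mono fun z => ENNReal.ofReal_le_ofReal ?_
  gcongr ?_ ^ _ / _
  exact abs_abs_sub_abs_le (u z.1) (u z.2)

theorem IsMinimizer.constant_sign (hN : 0 < N) (hs0 : 0 < s) (hs1 : s < 1) (hp : 1 < p)
    (hsp : s * p < N) {w u : EuclideanSpace ℝ (Fin N) → ℝ} (hu : IsMinimizer s p w u) :
    (∀ᵐ x ∂volume, 0 ≤ u x) ∨ (∀ᵐ x ∂volume, u x ≤ 0) := by
  obtain ⟨c, -, hc⟩ := hu.exists_const_mul hN hs0 hs1 hp hsp (hu.abs hN hs0 hs1 hp hsp)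
  rcases le_total 0 c with h | h
  · left
    filter_upwards [hc] with x hx
    rw [hx]
    positivity
  · right
    filter_upwards [hc] with x hx
    rw [hx]
    exact mul_nonpos_of_nonpos_of_nonneg h (abs_nonneg _)

/-! ### Strong maximum principle -/

theorem max_sub_mul_sub_max_le {m a b e f : ℝ} (hm : 0 < m) (he : e ≤ 1) (hba : b < a) :
    max (e - m * a) 0 - max (f - m * b) 0 ≤
      |e - f| * if a ≤ 1 / m ∧ b ≤ 1 / m then 1 else 0 := by
  have hmax : f - m * b ≤ max (f - m * b) 0 := le_max_left _ _
  have hmax0 : 0 ≤ max (f - m * b) 0 := le_max_right _ _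
  rcases le_or_gt (e - m * a) 0 with h | h
  · rw [max_eq_right h]
    have : 0 ≤ |e - f| * if a ≤ 1 / m ∧ b ≤ 1 / m then (1 : ℝ) else 0 := by
      split_ifs <;> simp
    linarith
  · have ha : a ≤ 1 / m := by
      rw [le_div_iff₀ hm]
      linarith
    have hmul : m * b ≤ m * a := mul_le_mul_of_nonneg_left hba.le hm.le
    rw [max_eq_left h.le, if_pos ⟨ha, hba.le.trans ha⟩, mul_one]
    linarith [le_abs_self (e - f)]

/-- The `-m u` part of the test function varies against `u` and has the favourable sign, so only the
increment of `η` survives in an upper bound, and only where `u ≤ 1/m` at both points. The bound is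
therefore uniform in `m`. -/
theorem form_trunc_le (hp : 1 < p) {m : ℝ} (hm : 0 < m) {u η : EuclideanSpace ℝ (Fin N) → ℝ}
    (hη : ∀ x, η x ≤ 1) (z : EuclideanSpace ℝ (Fin N) × EuclideanSpace ℝ (Fin N)) :
    |gquot s p u z| ^ (p - 2) * gquot s p u z *
        gquot s p (fun x => max (η x - m * u x) 0) z ≤
      |gquot s p u z| ^ (p - 1) * |gquot s p η z| *
        if u z.1 ≤ 1 / m ∧ u z.2 ≤ 1 / m then 1 else 0 := by
  have hrhs : 0 ≤ |gquot s p u z| ^ (p - 1) * |gquot s p η z| *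
      if u z.1 ≤ 1 / m ∧ u z.2 ≤ 1 / m then (1 : ℝ) else 0 := by
    split_ifs <;> positivity
  have hR : 0 ≤ ‖z.1 - z.2‖ ^ (((N : ℝ) + s * p) / p) := by positivity
  have hηR : |gquot s p η z| = |η z.1 - η z.2| / ‖z.1 - z.2‖ ^ (((N : ℝ) + s * p) / p) := by
    rw [gquot, abs_div, abs_of_nonneg hR]
  rcases lt_trichotomy (u z.1) (u z.2) with h | h | h
  · have hneg : gquot s p u z ≤ 0 := div_nonpos_of_nonpos_of_nonneg (by linarith) hR
    rw [abs_rpow_sub_two_mul_of_nonpos hp hneg, neg_mul, ← mul_neg, mul_assoc]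
    refine mul_le_mul_of_nonneg_left ?_ (by positivity)
    rw [hηR, div_mul_eq_mul_div, gquot, ← neg_div, neg_sub, abs_sub_comm (η z.1)]
    simp only [and_comm (a := u z.1 ≤ 1 / m)]
    refine div_le_div_of_nonneg_right ?_ hR
    exact max_sub_mul_sub_max_le hm (hη _) h
  · refine le_trans (le_of_eq ?_) hrhs
    simp [gquot, h]
  · have hpos : 0 ≤ gquot s p u z := div_nonneg (by linarith) hR
    rw [abs_rpow_sub_two_mul_of_nonneg hp hpos, mul_assoc]
    refine mul_le_mul_of_nonneg_left ?_ (by positivity)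
    rw [hηR, div_mul_eq_mul_div, gquot]
    refine div_le_div_of_nonneg_right ?_ hR
    exact max_sub_mul_sub_max_le hm (hη _) h

theorem lipschitzWith_trunc {m : ℝ} (hm : 0 ≤ m) :
    LipschitzWith ⟨1 + m, by positivity⟩ (fun a : ℝ × ℝ => max (a.1 - m * |a.2|) 0) := by
  refine LipschitzWith.of_dist_le_mul fun a b => ?_
  have h1 : |a.1 - b.1| ≤ dist a b := le_max_left _ _
  have h2 : |a.2 - b.2| ≤ dist a b := le_max_right _ _
  rw [Real.dist_eq]
  refine (abs_max_sub_max_le_abs _ _ _).trans ?_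
  calc |a.1 - m * |a.2| - (b.1 - m * |b.2|)|
      = |(a.1 - b.1) - m * (|a.2| - |b.2|)| := by ring_nf
    _ ≤ |a.1 - b.1| + |m * (|a.2| - |b.2|)| := abs_sub _ _
    _ = |a.1 - b.1| + m * |(|a.2| - |b.2|)| := by rw [abs_mul, abs_of_nonneg hm]
    _ ≤ dist a b + m * dist a b := by
        gcongr
        exact (abs_abs_sub_abs_le _ _).trans h2
    _ = (1 + m) * dist a b := by ring

/-- With `I n ≤ B n` a.e. and both integrals tending to `0`, the difference `B n - I n` tends to `0`
in `L¹`, hence a.e. along a subsequence. At an excluded pair it is eventually a positive constant.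
-/
theorem ae_not_pos_and_zero_of_isEigenfunction (hN : 0 < N) (hs0 : 0 < s) (hs1 : s < 1)
    (hp : 1 < p) (hsp : s * p < N) {w u η : EuclideanSpace ℝ (Fin N) → ℝ} {lam : ℝ}
    (hw : LocallyIntegrable w volume) (hu : IsEigenfunction s p w lam u)
    (hu0 : ∀ᵐ x ∂volume, 0 ≤ u x) (hη : ContDiff ℝ 1 η) (hηc : HasCompactSupport η)
    (hη0 : ∀ x, 0 ≤ η x) (hη1 : ∀ x, η x ≤ 1) :
    ∀ᵐ z : EuclideanSpace ℝ (Fin N) × EuclideanSpace ℝ (Fin N),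
      ¬ (0 < u z.1 ∧ u z.2 = 0 ∧ 0 < η z.2) := by
  have hp0 : 0 < p := by linarith
  obtain ⟨hD, -, heq⟩ := hu
  have hDη : MemD s p η := memD_of_contDiff hp0 hη hηc
  have hGu := hD.memLp_gquot hN hs0 hs1 hp
  have hGη := hDη.memLp_gquot hN hs0 hs1 hp
  let m : ℕ → ℝ := fun n => n + 1
  have hm (n : ℕ) : 0 < m n := by positivity
  have hm_top : Tendsto m atTop atTop :=
    tendsto_atTop_add_const_right _ _ tendsto_natCast_atTop_atTop
  have hm_inv : Tendsto (fun n => 1 / m n) atTop (𝓝 0) := tendsto_one_div_add_atTop_nhds_zero_nat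
  -- The absolute value makes `v n ≤ η`, and `|u| ≤ 1/m` where `v n > 0`, hold everywhere although
  -- `u ≥ 0` only a.e.
  let v : ℕ → EuclideanSpace ℝ (Fin N) → ℝ := fun n x => max (η x - m n * |u x|) 0
  have hDv (n : ℕ) : MemD s p (v n) :=
    hDη.comp_lipschitz hN hs0 hs1 hp hsp hD (lipschitzWith_trunc (hm n).le) (by simp)
  let I : ℕ → EuclideanSpace ℝ (Fin N) × EuclideanSpace ℝ (Fin N) → ℝ := fun n z =>
    |gquot s p u z| ^ (p - 2) * gquot s p u z * gquot s p (v n) z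
  let B : ℕ → EuclideanSpace ℝ (Fin N) × EuclideanSpace ℝ (Fin N) → ℝ := fun n z =>
    |gquot s p u z| ^ (p - 1) * |gquot s p η z| *
      if u z.1 ≤ 1 / m n ∧ u z.2 ≤ 1 / m n then 1 else 0
  have hu1 : ∀ᵐ z : EuclideanSpace ℝ (Fin N) × EuclideanSpace ℝ (Fin N),
      0 ≤ u z.1 ∧ 0 ≤ u z.2 := by
    rw [Measure.volume_eq_prod]
    exact (Measure.quasiMeasurePreserving_fst.ae hu0).and
      (Measure.quasiMeasurePreserving_snd.ae hu0)
  have hIi (n : ℕ) : Integrable (I n) volume :=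
    integrable_form hp hGu ((hDv n).memLp_gquot hN hs0 hs1 hp)
  have hdom := integrable_rpow_sub_one_mul hp hGu hGη
  have hBm (n : ℕ) : AEStronglyMeasurable (B n) volume := by
    refine hdom.1.mul ?_
    have hmeas : Measurable (fun q : ℝ × ℝ =>
        if q.1 ≤ 1 / m n ∧ q.2 ≤ 1 / m n then (1 : ℝ) else 0) := by
      refine Measurable.ite ?_ measurable_const measurable_const
      exact (measurableSet_le measurable_fst measurable_const).inter
        (measurableSet_le measurable_snd measurable_const)
    have hpair : AEMeasurable (fun z : EuclideanSpace ℝ (Fin N) × EuclideanSpace ℝ (Fin N) =>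
        (u z.1, u z.2)) volume := by
      rw [Measure.volume_eq_prod]
      exact hD.1.comp_fst.aemeasurable.prodMk hD.1.comp_snd.aemeasurable
    exact (hmeas.comp_aemeasurable hpair).aestronglyMeasurable
  have hBle (n : ℕ) : ∀ᵐ z, ‖B n z‖ ≤ |gquot s p u z| ^ (p - 1) * |gquot s p η z| := by
    refine ae_of_all _ fun z => ?_
    have : 0 ≤ |gquot s p u z| ^ (p - 1) * |gquot s p η z| := by positivity
    rw [Real.norm_eq_abs, abs_mul, abs_of_nonneg this]
    split_ifs <;> simp [this]
  have hBi (n : ℕ) : Integrable (B n) volume := hdom.mono' (hBm n) (hBle n)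
  have hBout {z : EuclideanSpace ℝ (Fin N) × EuclideanSpace ℝ (Fin N)}
      (hz : 0 < u z.1 ∨ 0 < u z.2) : ∀ᶠ n in atTop, B n z = 0 := by
    have : ∀ᶠ n in atTop, ¬ (u z.1 ≤ 1 / m n ∧ u z.2 ≤ 1 / m n) := by
      rcases hz with hz | hz
      · filter_upwards [hm_inv.eventually_lt_const hz] with n hn h
        linarith [h.1]
      · filter_upwards [hm_inv.eventually_lt_const hz] with n hn h
        linarith [h.2]
    filter_upwards [this] with n hn
    simp only [B, if_neg hn, mul_zero]
  have hBlim : Tendsto (fun n => ∫ z, B n z) atTop (𝓝 0) := by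
    have : Tendsto (fun n => ∫ z, B n z) atTop
        (𝓝 (∫ _ : EuclideanSpace ℝ (Fin N) × EuclideanSpace ℝ (Fin N), (0 : ℝ))) := by
      refine tendsto_integral_of_dominated_convergence _ hBm hdom hBle ?_
      filter_upwards [hu1] with z hz
      by_cases h : 0 < u z.1 ∨ 0 < u z.2
      · exact tendsto_const_nhds.congr' ((hBout h).mono fun n hn => hn.symm)
      · push Not at h
        have h1 : gquot s p u z = 0 := by
          rw [gquot, le_antisymm h.1 hz.1, le_antisymm h.2 hz.2, sub_self, zero_div]
        have h2 : p - 1 ≠ 0 := by linarith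
        simp [B, h1, h2]
    simpa using this
  have hIlim : Tendsto (fun n => ∫ z, I n z) atTop (𝓝 0) := by
    have hwη : Integrable (fun x => |w x| * η x) volume := by
      have := (hw.integrable_smul_right_of_hasCompactSupport hη.continuous hηc).norm
      simpa only [norm_smul, Real.norm_eq_abs, abs_of_nonneg (hη0 _)] using this
    have e (n : ℕ) : ∫ z, I n z = lam * ∫ x, w x * (|u x| ^ (p - 2) * u x) * v n x := by
      rw [← (heq (v n) (hDv n)).2]
      exact integral_congr_ae (ae_of_all _ fun z => (form_integrand_eq hp0 u (v n) z).symm)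
    -- Where `v n ≠ 0` the factor `|u|^(p-1)` is at most `(1/m)^(p-1)`, which tends to `0` since `p
    -- > 1`; compact support of `η` reduces the weight to local integrability.
    have hbound (n : ℕ) : ‖∫ x, w x * (|u x| ^ (p - 2) * u x) * v n x‖ ≤
        (1 / m n) ^ (p - 1) * ∫ x, |w x| * η x := by
      rw [← integral_const_mul]
      refine norm_integral_le_of_norm_le (hwη.const_mul _) (ae_of_all _ fun x => ?_)
      have hv0 : 0 ≤ v n x := le_max_right _ _
      rw [norm_mul, norm_mul, Real.norm_eq_abs (_ * u x), abs_rpow_sub_two_mul_self hp,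
        Real.norm_of_nonneg hv0, Real.norm_eq_abs]
      rcases le_or_gt (η x - m n * |u x|) 0 with h | h
      · have : v n x = 0 := max_eq_right h
        rw [this, mul_zero]
        have := hη0 x
        have := hm n
        positivity
      · have hvη : v n x ≤ η x := by
          have := mul_nonneg (hm n).le (abs_nonneg (u x))
          exact max_le (by linarith) (hη0 x)
        have hum : |u x| ≤ 1 / m n := by
          rw [le_div_iff₀ (hm n)]
          linarith [hη1 x]
        have hum' : |u x| ^ (p - 1) ≤ (1 / m n) ^ (p - 1) :=
          Real.rpow_le_rpow (abs_nonneg _) hum (by linarith)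
        calc |w x| * |u x| ^ (p - 1) * v n x ≤ |w x| * (1 / m n) ^ (p - 1) * η x := by
              have := hm n
              gcongr
          _ = _ := by ring
    have h0 : Tendsto (fun n => (1 / m n) ^ (p - 1) * ∫ x, |w x| * η x) atTop (𝓝 0) := by
      have := (hm_inv.rpow_const (p := p - 1) (Or.inr (by linarith))).mul_const
        (∫ x, |w x| * η x)
      rwa [Real.zero_rpow (by linarith), zero_mul] at this
    have := (squeeze_zero_norm hbound h0).const_mul lam
    rw [mul_zero] at this
    exact this.congr fun n => (e n).symm
  have hIB (n : ℕ) : ∀ᵐ z, I n z ≤ B n z := by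
    filter_upwards [hu1] with z hz
    have hg : gquot s p (v n) z = gquot s p (fun x => max (η x - m n * u x) 0) z := by
      simp only [gquot, v, abs_of_nonneg hz.1, abs_of_nonneg hz.2]
    simp only [I, B, hg]
    exact form_trunc_le hp (hm n) hη1 z
  have hL : Tendsto (fun n => eLpNorm (B n - I n - 0) 1 volume) atTop (𝓝 0) := by
    have h1 (n : ℕ) : eLpNorm (B n - I n - 0) 1 volume =
        ENNReal.ofReal ((∫ z, B n z) - ∫ z, I n z) := by
      rw [sub_zero, eLpNorm_one_eq_lintegral_enorm, ← integral_sub' (hBi n) (hIi n),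
        ofReal_integral_eq_lintegral_ofReal ((hBi n).sub (hIi n))]
      · refine lintegral_congr_ae ?_
        filter_upwards [hIB n] with z hz
        rw [Pi.sub_apply, Real.enorm_of_nonneg (by linarith)]
      · filter_upwards [hIB n] with z hz
        simpa using hz
    simp only [h1]
    have := (ENNReal.continuous_ofReal.tendsto _).comp (hBlim.sub hIlim)
    simpa [Function.comp_def] using this
  obtain ⟨k, hk, hae⟩ := (tendstoInMeasure_of_tendsto_eLpNorm one_ne_zero
    (fun n => (hBm n).sub (hIi n).1) aestronglyMeasurable_const hL).exists_seq_tendsto_ae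
  filter_upwards [hae, hu1] with z hz hzu ⟨hz1, hz2, hzη⟩
  have hne : z.1 ≠ z.2 := fun h => by
    rw [h] at hz1
    exact hz1.ne' hz2
  have hR : 0 < ‖z.1 - z.2‖ ^ (((N : ℝ) + s * p) / p) :=
    Real.rpow_pos_of_pos (norm_pos_iff.2 (sub_ne_zero.2 hne)) _
  have hG : 0 < gquot s p u z := div_pos (by linarith) hR
  let K : ℝ := |gquot s p u z| ^ (p - 2) * gquot s p u z *
    (η z.2 / ‖z.1 - z.2‖ ^ (((N : ℝ) + s * p) / p))
  have hK : 0 < K := by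
    have := Real.rpow_pos_of_pos (abs_pos.2 hG.ne') (p - 2)
    positivity
  -- Once `m u(x) ≥ 1 ≥ η(x)`, the test function is `0` at `x` but still `η(y)` at `y`, so `-I n`
  -- freezes at `K > 0` while `B n` vanishes.
  have hev : ∀ᶠ n in atTop, (B n - I n) z = K := by
    have hlarge : ∀ᶠ n in atTop, 1 / u z.1 ≤ m n := hm_top.eventually_ge_atTop _
    filter_upwards [hBout (Or.inl hz1), hlarge] with n hn hl
    have hv1 : v n z.1 = 0 := by
      refine max_eq_right ?_
      rw [div_le_iff₀ hz1] at hl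
      rw [abs_of_pos hz1]
      linarith [hη1 z.1]
    have hv2 : v n z.2 = η z.2 := by
      simp only [v, hz2, abs_zero, mul_zero, sub_zero]
      exact max_eq_left hzη.le
    rw [Pi.sub_apply, hn]
    simp only [I, K]
    rw [show gquot s p (v n) z = (v n z.1 - v n z.2) / _ from rfl, hv1, hv2]
    ring
  have hlimK : Tendsto (fun i => (B (k i) - I (k i)) z) atTop (𝓝 K) :=
    tendsto_const_nhds.congr' ((hk.tendsto_atTop.eventually hev).mono fun i hi => hi.symm)
  exact hK.ne' (tendsto_nhds_unique hlimK hz)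

/-- Strong maximum principle for nonnegative eigenfunctions with a locally integrable weight. -/
theorem IsEigenfunction.ae_pos (hN : 0 < N) (hs0 : 0 < s) (hs1 : s < 1) (hp : 1 < p)
    (hsp : s * p < N) {w u : EuclideanSpace ℝ (Fin N) → ℝ} {lam : ℝ}
    (hw : LocallyIntegrable w volume) (hu : IsEigenfunction s p w lam u)
    (hu0 : ∀ᵐ x ∂volume, 0 ≤ u x) : ∀ᵐ x ∂volume, 0 < u x := by
  -- Countably many cutoffs whose positivity sets, balls of radius `n + 2`, exhaust the space, so
  -- the exceptional null sets can be united.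
  let η : ℕ → ContDiffBump (0 : EuclideanSpace ℝ (Fin N)) := fun n =>
    ⟨n + 1, n + 2, by positivity, by linarith⟩
  have h : ∀ᵐ z : EuclideanSpace ℝ (Fin N) × EuclideanSpace ℝ (Fin N),
      ¬ (0 < u z.1 ∧ u z.2 = 0) := by
    have hall := ae_all_iff.2 fun n => ae_not_pos_and_zero_of_isEigenfunction hN hs0 hs1 hp hsp
      hw hu hu0 (η n).contDiff (η n).hasCompactSupport (fun _ => (η n).nonneg)
      (fun _ => (η n).le_one)
    filter_upwards [hall] with z hz ⟨h1, h2⟩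
    obtain ⟨n, hn⟩ := exists_nat_gt ‖z.2‖
    refine hz n ⟨h1, h2, (η n).pos_of_mem_ball ?_⟩
    rw [mem_ball_zero_iff]
    change ‖z.2‖ < (n : ℝ) + 2
    linarith
  rw [Measure.volume_eq_prod] at h
  have hex : ∃ᵐ x ∂(volume : Measure (EuclideanSpace ℝ (Fin N))), u x ≠ 0 := fun h0 =>
    hu.2.1 (h0.mono fun x hx => not_not.1 hx)
  obtain ⟨x, hx, hx0, hxy⟩ :=
    (hex.and_eventually (hu0.and (Measure.ae_ae_of_ae_prod h))).exists
  have hxpos : 0 < u x := hx0.lt_of_ne' hx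
  filter_upwards [hxy, hu0] with y hy hy0
  exact hy0.lt_of_ne' fun h0 => hy ⟨hxpos, h0⟩

end FracHardy

theorem mainTheorem7 (N : ℕ) (s p : ℝ) (hs0 : 0 < s) (hs1 : s < 1) (hp : 1 < p)
    (hsp : s * p < (N : ℝ)) (w₁ w₂ : EuclideanSpace ℝ (Fin N) → ℝ)
    (hw₁_nonneg : ∀ᵐ x ∂(volume : Measure (EuclideanSpace ℝ (Fin N))), 0 ≤ w₁ x)
    (hw₂_nonneg : ∀ᵐ x ∂(volume : Measure (EuclideanSpace ℝ (Fin N))), 0 ≤ w₂ x)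
    (hw₁ : FracHardy.MemHardyZero s p w₁) (hw₂ : LocallyIntegrable w₂ volume) :
    (∀ u : EuclideanSpace ℝ (Fin N) → ℝ, FracHardy.IsFirstEigenfunction s p (w₁ - w₂) u →
      (∀ᵐ x ∂volume, 0 ≤ u x) ∨ (∀ᵐ x ∂volume, u x ≤ 0)) ∧
    (∀ u : EuclideanSpace ℝ (Fin N) → ℝ, FracHardy.IsFirstEigenfunction s p (w₁ - w₂) u →
      (∀ᵐ x ∂volume, 0 ≤ u x) → ∀ᵐ x ∂volume, 0 < u x) ∧
    (∀ u v : EuclideanSpace ℝ (Fin N) → ℝ, FracHardy.IsFirstEigenfunction s p (w₁ - w₂) u →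
      FracHardy.IsFirstEigenfunction s p (w₁ - w₂) v →
      ∃ c : ℝ, c ≠ 0 ∧ ∀ᵐ x ∂volume, u x = c * v x) := by
  have hN : 0 < N := by
    have : (0 : ℝ) < N := lt_trans (by positivity) hsp
    exact_mod_cast this
  refine ⟨fun u hu => ?_, fun u hu hu0 => ?_, fun u v hu hv => ?_⟩
  · exact (hu.isMinimizer hN hs0 hs1 hp hsp).constant_sign hN hs0 hs1 hp hsp
  · exact hu.2.ae_pos hN hs0 hs1 hp hsp (hw₁.1.1.sub hw₂) hu0
  · exact (hu.isMinimizer hN hs0 hs1 hp hsp).exists_const_mul hN hs0 hs1 hp hsp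
      (hv.isMinimizer hN hs0 hs1 hp hsp)
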